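/- Let $X$ be a finite set, let $X^*$ be the set of finite words over $X$, regarded as a rooted tree and ordered by the prefix relation, and let $\mathrm{Aut}(X^*)$ be the group of bijections $g$ of $X^*$ such that $u$ is a prefix of $v$ if and only if $g(u)$ is a prefix of $g(v)$. For $g\in\mathrm{Aut}(X^*)$ and $u\in X^*$ the section $g_u\in\mathrm{Aut}(X^*)$ is defined by $g(uw)=g(u)g_u(w)$ for all $w\in X^*$; write $\psi_u(g)=g_u$. For $G\le \mathrm{Aut}(X^*)$ and $Y\subseteq X^*$ let $\mathrm{st}_G(Y)$ be the pointwise stabilizer of $Y$ in $G$, and $\mathrm{st}_G(n)=\mathrm{st}_G(X^n)$. For $K\le\mathrm{Aut}(X^*)$ and $Y$ a finite set of pairwise prefix-incomparable words, $K^Y\le \mathrm{Aut}(X^*)$ is the group of all $g$ that fix every vertex not below a vertex of $Y$, fix every $y\in Y$, and satisfy $g_y\in K$ for all $y\in Y$. A *spanning leaf set* is a finite set $Y\subseteq X^*$ of pairwise prefix-incomparable words such that, for some $N$, every word of length at least $N$ has a prefix in $Y$. For $H\le G$ and $Y$ a spanning leaf set, *$\mathrm{st}_H(Y)$ is an infra-direct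 product of $G^Y$* if for every $y\in Y$ the group $\psi_y(\mathrm{st}_H(Y))$ is a subgroup of finite index of $G$. Suppose that $G\le\mathrm{Aut}(X^*)$ satisfies all of the following. - $G$ is finitely generated, and it is just infinite: it is infinite and all its proper quotients are finite. - $G$ is a regular branch group: $g_x\in G$ for all $g\in G$ and $x\in X^*$ (self-similarity), $G$ acts transitively on each level $X^n$, and there is a normal subgroup $K$ of finite index in $G$ such that $K^{\{x\}}\le K$ for all $x\in X^*$ and $K^{X^n}$ has finite index in $G$ for all $n$. - $G$ is strongly self-replicating: it is self-similar and $\psi_x(\mathrm{st}_G(n))=G$ for all $n\ge 1$ and $x\in X^n$. - $G$ has well-approximated subgroups: $\bigcap_{n\ge0}H\,\mathrm{st}_G(n)=H$ for every finitely generated $H\le G$. - $G$ obeys the Grigorchuk--Nagnibeda alternative: for every finitely generated $H\le G$, either the set $\psi_y(H)$ is finite for some $y\in X^*$, or there is a spanning leaf set $Y$ such that $\mathrm{st}_H(Y)$ is an infra-direct product of $G^Y$. Let $\mathrm{Sub}(G)$ be the space of subgroups of $G$ with the Chabauty topology, that is, the topology induced by $\{0,1\}^G$ via indicator functions. For an ordinal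 $\alpha$ let $\mathrm{Sub}(G)^{\alpha}$ be its $\alpha$-th Cantor--Bendixson derivative (take the set of limit points at successor steps and intersections at limit steps). The perfect kernel of $\mathrm{Sub}(G)$ is the derivative at which this decreasing sequence stabilizes. For $L\le G$ let $\mathrm{rk_{CB}}(L)$ be the ordinal $\alpha$ with $L\in \mathrm{Sub}(G)^{\alpha}\setminus \mathrm{Sub}(G)^{\alpha+1}$ if there is one, and $\mathrm{rk_{CB}}(L)=\infty$, which is greater than every ordinal, otherwise. Let $\mathrm{depth}(L)\in\mathbb{N}\cup\{\infty\}$ be the supremum of the $n\in\mathbb N$ for which there is a series of subgroups $G=H_0>H_1>\dots>H_n=L$ with $|H_i:H_{i+1}|=\infty$ for all $i<n$ (with $\sup\emptyset=0$). Then for every $L\le G$ the following are equivalent: 1. $L$ is not a member of the perfect kernel of $\mathrm{Sub}(G)$. 2. There is a spanning leaf set $Y$ such that $\mathrm{st}_L(Y)$ is an infra-direct product of $G^Y$. 3. $\mathrm{rk_{CB}}(L)<\omega$. 4. $\mathrm{depth}(L)<\infty$ and $L$ is finitely generated. -/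

import Mathlib

namespace TreeGroup

/-! ### Cantor-Bendixson rank of points -/

/-- The Cantor-Bendixson rank of the point `x`: the ordinal `a` with
`x ∈ X^a \ X^(a+1)` if there is one (it is then unique), and `⊤` otherwise. -/
noncomputable def cbRank {S : Type*} [TopologicalSpace S] (x : S) : WithTop Ordinal :=
  sInf {r : WithTop Ordinal | ∃ a : Ordinal, r = a ∧
    x ∈ CantorBendixson.iteratedDerivedSet (Set.univ : Set S) a ∧
    x ∉ CantorBendixson.iteratedDerivedSet (Set.univ : Set S) (a + 1)}

theorem cbRank_eq_coe {S : Type*} [TopologicalSpace S] {x : S} {a : Ordinal}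
    (h : x ∈ CantorBendixson.iteratedDerivedSet (Set.univ : Set S) a)
    (h' : x ∉ CantorBendixson.iteratedDerivedSet (Set.univ : Set S) (a + 1)) :
    cbRank x = (a : WithTop Ordinal) := by
  apply IsLeast.csInf_eq
  refine ⟨⟨a, rfl, h, h'⟩, ?_⟩
  rintro r ⟨b, rfl, _, hb'⟩
  refine WithTop.coe_le_coe.2 (not_lt.1 fun hlt => hb' ?_)
  exact CantorBendixson.iteratedDerivedSet_antitone _ (Order.add_one_le_of_lt hlt) h

theorem cbRank_eq_top {S : Type*} [TopologicalSpace S] {x : S}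
    (h : ∀ a : Ordinal, x ∈ CantorBendixson.iteratedDerivedSet (Set.univ : Set S) a →
      x ∈ CantorBendixson.iteratedDerivedSet (Set.univ : Set S) (a + 1)) :
    cbRank x = ⊤ := by
  have : {r : WithTop Ordinal | ∃ a : Ordinal, r = a ∧
      x ∈ CantorBendixson.iteratedDerivedSet (Set.univ : Set S) a ∧
      x ∉ CantorBendixson.iteratedDerivedSet (Set.univ : Set S) (a + 1)} = ∅ := by
    ext r
    simp only [Set.mem_ofPred_eq, Set.mem_empty_iff_false, iff_false]
    rintro ⟨a, _, h1, h2⟩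
    exact h2 (h a h1)
  rw [cbRank, this, WithTop.sInf_empty]

/-- The perfect kernel of a space is its `a`-th Cantor-Bendixson derivative, where `a` is the
least ordinal at which the derivatives stabilise (the Cantor-Bendixson rank of the space). -/
theorem perfectKernel_univ_eq (S : Type*) [TopologicalSpace S] :
    CantorBendixson.perfectKernel (Set.univ : Set S) =
      CantorBendixson.iteratedDerivedSet (Set.univ : Set S)
        (sInf {a : Ordinal | CantorBendixson.iteratedDerivedSet (Set.univ : Set S) a =
          CantorBendixson.iteratedDerivedSet (Set.univ : Set S) (a + 1)}) := by
  apply CantorBendixson.perfectKernel_eq_iteratedDerivedSet_of_mem_fixedPoints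
  apply CantorBendixson.mem_fixedPoints_of_iteratedDerivedSet_succ_eq
  have hne : {a : Ordinal | CantorBendixson.iteratedDerivedSet (Set.univ : Set S) a =
      CantorBendixson.iteratedDerivedSet (Set.univ : Set S) (a + 1)}.Nonempty := by
    obtain ⟨a, ha⟩ := CantorBendixson.iteratedDerivedSet_mem_fixedPoints (Set.univ : Set S)
    refine ⟨a, ?_⟩
    rw [Set.mem_ofPred_eq, CantorBendixson.iteratedDerivedSet_succ]
    exact ha.symm
  exact (csInf_mem hne).symm

/-! ### Groups -/

/-- The Chabauty topology on the set `Sub(Γ)` of subgroups of `Γ`: a subgroup is identified with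
its indicator function in `{0,1}^Γ`, which carries the product of the discrete topologies. -/
noncomputable instance chabauty (Γ : Type*) [Group Γ] : TopologicalSpace (Subgroup Γ) :=
  TopologicalSpace.induced (fun (H : Subgroup Γ) (g : Γ) => (open Classical in decide (g ∈ H)))
    (Pi.topologicalSpace : TopologicalSpace (Γ → Bool))

/-- `H` is a subgroup of finite index of the subgroup `K` (in particular `H ≤ K`). -/
def FiniteIndexIn {A : Type*} [Group A] (H K : Subgroup A) : Prop :=
  H ≤ K ∧ H.relIndex K ≠ 0

/-- The group `Γ` is infinite and all its proper quotients are finite. -/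
def JustInfinite (Γ : Type*) [Group Γ] : Prop :=
  Infinite Γ ∧ ∀ N : Subgroup Γ, N.Normal → N ≠ ⊥ → Finite (Γ ⧸ N)

/-- There is a series `Γ = H 0 > H 1 > ⋯ > H n = L` with all indices `|H i : H (i+1)|` infinite
(an infinite index being recorded as `relIndex = 0`). -/
def HasInfiniteIndexSeries {Γ : Type*} [Group Γ] (L : Subgroup Γ) (n : ℕ) : Prop :=
  ∃ H : ℕ → Subgroup Γ, H 0 = ⊤ ∧ H n = L ∧
    ∀ i < n, H (i + 1) < H i ∧ (H (i + 1)).relIndex (H i) = 0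

/-- The depth of `L` in `Γ`: the supremum of the lengths of such series. -/
noncomputable def depth {Γ : Type*} [Group Γ] (L : Subgroup Γ) : ℕ∞ :=
  sSup {m : ℕ∞ | ∃ n : ℕ, m = n ∧ HasInfiniteIndexSeries L n}

/-- For a subgroup `G` of a group `A`, the subgroup `H` of `A^Y` is an infra-direct product of
`G^Y`: each coordinate projection of `H` is a finite index subgroup of `G` (so `H ≤ G^Y`). -/
def IsInfraDirect {A ι : Type*} [Group A] (G : Subgroup A) (H : Subgroup (ι → A)) : Prop :=
  ∀ i : ι, FiniteIndexIn (H.map (Pi.evalMonoidHom (fun _ : ι => A) i)) G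

/-! ### The regular rooted tree and its automorphisms -/

/-- `Aut(X^*)`: the bijections of the set `X^*` of finite words over `X` that preserve and reflect
the prefix relation. -/
abbrev TreeAut (X : Type*) : Type _ :=
  ((· <+: ·) : List X → List X → Prop) ≃r ((· <+: ·) : List X → List X → Prop)

variable {X : Type*}

/-- The words of length `n`. -/
def level (X : Type*) (n : ℕ) : Set (List X) := {u | u.length = n}

/-- A leaf set: a finite set of pairwise prefix-incomparable words. -/
def IsLeafSet (Y : Set (List X)) : Prop :=
  Y.Finite ∧ ∀ x ∈ Y, ∀ y ∈ Y, x ≠ y → ¬ x <+: y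

/-- A spanning leaf set: a leaf set such that each sufficiently long word has a prefix in it. -/
def IsSpanningLeafSet (Y : Set (List X)) : Prop :=
  IsLeafSet Y ∧ ∃ N : ℕ, ∀ x : List X, N ≤ x.length → ∃ y ∈ Y, y <+: x

theorem apply_append_drop (g : TreeAut X) (u w : List X) :
    g u ++ (g (u ++ w)).drop (g u).length = g (u ++ w) := by
  have h : g u <+: g (u ++ w) := g.map_rel_iff.2 (List.prefix_append u w)
  obtain ⟨t, ht⟩ := h
  rw [← ht, List.drop_left]

/-- The section `g_u`: the automorphism with `g (u ++ w) = g u ++ g_u w` for all `w`. -/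
def sectionAt (g : TreeAut X) (u : List X) : TreeAut X where
  toFun w := (g (u ++ w)).drop (g u).length
  invFun w := (g⁻¹ (g u ++ w)).drop u.length
  left_inv w := by
    simp only
    rw [apply_append_drop, RelIso.inv_apply_self, List.drop_left]
  right_inv w := by
    have h := apply_append_drop g⁻¹ (g u) w
    rw [RelIso.inv_apply_self] at h
    simp only
    rw [h, RelIso.apply_inv_self, List.drop_left]
  map_rel_iff' := by
    intro v w
    simp only [Equiv.coe_fn_mk]
    rw [← List.prefix_append_right_inj (g u), apply_append_drop, apply_append_drop,
      g.map_rel_iff, List.prefix_append_right_inj]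

theorem apply_append (g : TreeAut X) (u w : List X) :
    g (u ++ w) = g u ++ sectionAt g u w :=
  (apply_append_drop g u w).symm

theorem sectionAt_unique {g s : TreeAut X} {u : List X}
    (h : ∀ w, g (u ++ w) = g u ++ s w) : sectionAt g u = s := by
  ext1 w
  exact List.append_cancel_left ((apply_append g u w).symm.trans (h w))

theorem sectionAt_one (u : List X) : sectionAt (1 : TreeAut X) u = 1 :=
  sectionAt_unique fun _ => rfl

theorem sectionAt_mul (g h : TreeAut X) (u : List X) :
    sectionAt (g * h) u = sectionAt g (h u) * sectionAt h u :=
  sectionAt_unique fun w => by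
    simp only [RelIso.mul_apply, apply_append]

/-- The pointwise stabilizer of a set `Y` of vertices in `Aut(X^*)`; the stabilizer `st_G(Y)` in a
subgroup `G` is `G ⊓ fixer Y`. -/
def fixer (Y : Set (List X)) : Subgroup (TreeAut X) where
  carrier := {g | ∀ y ∈ Y, g y = y}
  one_mem' := fun _ _ => rfl
  mul_mem' := by
    intro g h hg hh y hy
    rw [RelIso.mul_apply, hh y hy, hg y hy]
  inv_mem' := by
    intro g hg y hy
    conv_lhs => rw [← hg y hy]
    exact RelIso.inv_apply_self g y

/-- The section maps at the vertices of `Y`, as a homomorphism on the stabilizer of `Y`. -/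
def sectionHom (Y : Set (List X)) : fixer Y →* (Y → TreeAut X) where
  toFun g y := sectionAt (g : TreeAut X) y
  map_one' := by
    funext y
    exact sectionAt_one _
  map_mul' := by
    intro g h
    funext y
    have hy : (h : TreeAut X) (y : List X) = y := h.2 y y.2
    simp only [Subgroup.coe_mul, Pi.mul_apply]
    rw [sectionAt_mul, hy]

/-- The stabilizer `st_H(Y)` regarded as a subgroup of `Aut(X^*)^Y` through the section maps. -/
def stabilizerImage (H : Subgroup (TreeAut X)) (Y : Set (List X)) : Subgroup (Y → TreeAut X) :=
  (H.subgroupOf (fixer Y)).map (sectionHom Y)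

/-- For a set `Y` of words, the group `K^Y` of those automorphisms that fix each vertex that is not
below a vertex of `Y`, fix each vertex of `Y`, and have a section in `K` at each vertex of `Y`. -/
def copies (K : Subgroup (TreeAut X)) (Y : Set (List X)) : Subgroup (TreeAut X) where
  carrier := {g | (∀ u : List X, (∀ y ∈ Y, ¬ y <+: u) → g u = u) ∧
    ∀ y ∈ Y, g y = y ∧ sectionAt g y ∈ K}
  one_mem' := ⟨fun _ _ => rfl, fun y _ => ⟨rfl, by rw [sectionAt_one]; exact K.one_mem⟩⟩
  mul_mem' := by
    rintro g h ⟨hg, hg'⟩ ⟨hh, hh'⟩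
    refine ⟨fun u hu => ?_, fun y hy => ⟨?_, ?_⟩⟩
    · rw [RelIso.mul_apply, hh u hu, hg u hu]
    · rw [RelIso.mul_apply, (hh' y hy).1, (hg' y hy).1]
    · rw [sectionAt_mul, (hh' y hy).1]
      exact K.mul_mem (hg' y hy).2 (hh' y hy).2
  inv_mem' := by
    rintro g ⟨hg, hg'⟩
    have key : ∀ u, g u = u → g⁻¹ u = u := fun u hu => by
      conv_lhs => rw [← hu]
      exact RelIso.inv_apply_self g u
    refine ⟨fun u hu => key u (hg u hu), fun y hy => ⟨key y (hg' y hy).1, ?_⟩⟩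
    have h1 : sectionAt g⁻¹ y * sectionAt g y = 1 := by
      have h2 := sectionAt_mul g⁻¹ g y
      rw [(hg' y hy).1, inv_mul_cancel, sectionAt_one] at h2
      exact h2.symm
    rw [eq_inv_of_mul_eq_one_left h1]
    exact K.inv_mem (hg' y hy).2

/-! ### Classes of groups of tree automorphisms -/

/-- `G` is self-similar: it contains all sections of its elements. -/
def IsSelfSimilar (G : Subgroup (TreeAut X)) : Prop :=
  ∀ g ∈ G, ∀ u : List X, sectionAt g u ∈ G

/-- `G` acts transitively on every level of the tree. -/
def IsLevelTransitive (G : Subgroup (TreeAut X)) : Prop :=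
  ∀ n : ℕ, ∀ u ∈ level X n, ∀ v ∈ level X n, ∃ g ∈ G, g u = v

/-- `K` is a branching subgroup for `G`. -/
def IsBranchingSubgroup (G K : Subgroup (TreeAut X)) : Prop :=
  FiniteIndexIn K G ∧ (K.subgroupOf G).Normal ∧
    (∀ x : List X, copies K {x} ≤ K) ∧
    ∀ n : ℕ, FiniteIndexIn (copies K (level X n)) G

/-- `G` is a regular branch group. -/
def IsRegularBranch (G : Subgroup (TreeAut X)) : Prop :=
  IsSelfSimilar G ∧ IsLevelTransitive G ∧ ∃ K : Subgroup (TreeAut X), IsBranchingSubgroup G K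

/-- `G` is strongly self-replicating: it is self-similar, and for all `n ≥ 1` and all words `x` of
length `n` the section map at `x` maps the stabilizer of level `n` onto `G`. -/
def IsStronglySelfReplicating (G : Subgroup (TreeAut X)) : Prop :=
  IsSelfSimilar G ∧ ∀ n : ℕ, 1 ≤ n → ∀ x ∈ level X n,
    (fun g => sectionAt g x) '' ((G ⊓ fixer (level X n) : Subgroup (TreeAut X)) : Set (TreeAut X))
      = (G : Set (TreeAut X))

open scoped Pointwise in
/-- `G` has well-approximated subgroups: each finitely generated `H ≤ G` is the intersection of
the products `H · st_G(n)`. -/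
def HasWellApproximatedSubgroups (G : Subgroup (TreeAut X)) : Prop :=
  ∀ H : Subgroup (TreeAut X), H ≤ G → H.FG →
    ⋂ n : ℕ, (H : Set (TreeAut X)) *
      ((G ⊓ fixer (level X n) : Subgroup (TreeAut X)) : Set (TreeAut X)) = (H : Set (TreeAut X))

/-- The Grigorchuk-Nagnibeda alternative. -/
def GrigorchukNagnibedaAlternative (G : Subgroup (TreeAut X)) : Prop :=
  ∀ H : Subgroup (TreeAut X), H ≤ G → H.FG →
    (∃ y : List X, ((fun h => sectionAt h y) '' (H : Set (TreeAut X))).Finite) ∨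
    ∃ Y : Set (List X), IsSpanningLeafSet Y ∧ IsInfraDirect G (stabilizerImage H Y)

end TreeGroup

/-!
For a vertex `u`, write `K^{u}` for `copies K {u}`: its elements `graft u k` act as `k ∈ K` below `u`
and trivially elsewhere. The proof rests on the commutator trick of branch groups: if `g` moves `u`,
then `⁅⁅graft u a, g⁆, graft u b⁆ = graft u ⁅a, b⁆` (`commutator_commutator_graft`). Hence a subgroup
of `G` that is normalized by `K^{u}` and moves `u` contains the group `K'^{u}`, where `K'` is the
commutator subgroup. Starting from a branching subgroup and passing to iterated commutator subgroups,
all groups `K` that occur are nontrivial, normal in `G` and contain `K^{u}` for all `u`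
(`IsGraftCore`), so they have finite index in the just infinite group `G`.

A normal subgroup `J` of finite index of `G` contains `K^{u}` for all vertices `u` of high level, and
is transitive on the levels below each vertex of some level `m` (`exists_isBase`). A subgroup `A ≤ G`
normalized by `J` is therefore known up to finite index from the finite set of those vertices of
level `m` below which `A` moves something (`exists_relIndex_le`), and it is finitely generated
(`fg_of_le_normalizer`).

Let `st_L(Y)` be an infra-direct product of `G^Y`, and let `J` be contained in all its coordinate
projections. For `M ≥ L`, the elements of `st_M(Y)` with prescribed trivial coordinates project to
subgroups of `G` normalized by `J`. The moved vertices of all these groups make up a finite set, the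
type of `M` (`branchType`). It grows with `M`, and if `M ≤ M'` have the same type, then `M` has finite
index in `M'`, bounded in terms of `M` only. It follows that

* `M` is finitely generated, so that its overgroups form a neighbourhood of `M`;
* the depth of `L` is at most the size of the type of `G`;
* only finitely many overgroups of `M` have the type of `M` (`IsFrame.finite_overgroups`): having
  bounded index over `M`, they normalize one of finitely many subgroups `N` of finite index of `M`,
  and `N` has finite index in its normalizer in `G`. Thus the overgroups of `M` near `M` have larger
  types, and the Cantor-Bendixson rank of `L` is bounded by the number of possible sizes of types.

Conversely, let a subgroup `H` have finitely many sections at a vertex, as the alternative provides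
when `H` is finitely generated and has no infra-direct stabilizer. The orbits of
such an `H` meet the levels below this vertex in sets of bounded size, and enlarging `H` by `K^O`, for an
orbit `O` on a high level, gives an overgroup with the same property, of infinite index over `H` and contained in `H st_G(n)`
(`exists_infinite_index_overgroup`). Iterating, the depth of `H` is infinite. As finitely generated
subgroups are well approximated, `H` is also a limit of such overgroups. Since subgroups that are not
finitely generated are limits of finitely generated ones, the subgroups without an infra-direct
stabilizer form a set without isolated points, which therefore lies in the perfect kernel.
-/

open TreeGroup
open scoped commutatorElement

/-! ### Automorphisms of the tree -/

namespace TreeGroup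

variable {X : Type*}

theorem length_le_length_apply (g : TreeAut X) (u : List X) : u.length ≤ (g u).length := by
  induction u using List.reverseRecOn with
  | nil => simp
  | append_singleton v x ih =>
    have h : g v <+: g (v ++ [x]) := g.map_rel_iff.2 (List.prefix_append v [x])
    have hne : g v ≠ g (v ++ [x]) := fun h => by simpa using g.injective h
    have hlt : (g v).length ≠ (g (v ++ [x])).length := fun hl => hne (h.eq_of_length hl)
    have := h.length_le
    simp only [List.length_append, List.length_singleton]
    omega

@[simp]
theorem length_apply (g : TreeAut X) (u : List X) : (g u).length = u.length := by
  refine le_antisymm ?_ (length_le_length_apply g u)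
  have := length_le_length_apply g⁻¹ (g u)
  rwa [RelIso.inv_apply_self] at this

theorem prefix_apply_iff (g : TreeAut X) {u v : List X} : g u <+: g v ↔ u <+: v :=
  g.map_rel_iff

theorem not_prefix_of_length_eq {u v : List X} (hl : u.length = v.length) (h : u ≠ v) :
    ¬ u <+: v :=
  fun hp => h (hp.eq_of_length hl)

theorem sectionAt_append (g : TreeAut X) (u v : List X) :
    sectionAt g (u ++ v) = sectionAt (sectionAt g u) v :=
  sectionAt_unique fun w => by
    rw [List.append_assoc, apply_append, apply_append, apply_append g u v, List.append_assoc]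

theorem sectionAt_inv_apply (g : TreeAut X) (u : List X) :
    sectionAt g⁻¹ (g u) = (sectionAt g u)⁻¹ := by
  apply eq_inv_of_mul_eq_one_left
  rw [← sectionAt_mul, inv_mul_cancel, sectionAt_one]

theorem apply_left_of_apply_append {g : TreeAut X} {u v u' v' : List X}
    (hl : u.length = u'.length) (h : g (u ++ v) = u' ++ v') : g u = u' ∧ sectionAt g u v = v' := by
  rw [apply_append] at h
  exact List.append_inj h (by rw [length_apply, hl])

open Classical in
/-- For an automorphism `a` of the tree and a vertex `u`, the automorphism that acts as `a` on the
subtree below `u`, identified with the whole tree, and fixes all other vertices. -/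
noncomputable def graftEquiv (u : List X) (a : TreeAut X) : TreeAut X where
  toFun v := if u <+: v then u ++ a (v.drop u.length) else v
  invFun v := if u <+: v then u ++ a⁻¹ (v.drop u.length) else v
  left_inv v := by
    by_cases h : u <+: v
    · obtain ⟨w, rfl⟩ := h
      simp
    · simp [h]
  right_inv v := by
    by_cases h : u <+: v
    · obtain ⟨w, rfl⟩ := h
      simp
    · simp [h]
  map_rel_iff' := by
    intro v w
    simp only [Equiv.coe_fn_mk]
    by_cases h : u <+: v <;> by_cases h' : u <+: w
    · obtain ⟨v, rfl⟩ := h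
      obtain ⟨w, rfl⟩ := h'
      simp [List.prefix_append_right_inj, prefix_apply_iff]
    · obtain ⟨v, rfl⟩ := h
      simp only [List.prefix_append, if_true, h', if_false]
      exact ⟨fun hp => absurd ((List.prefix_append _ _).trans hp) h',
        fun hp => absurd ((List.prefix_append _ _).trans hp) h'⟩
    · obtain ⟨w, rfl⟩ := h'
      simp only [List.prefix_append, if_true, h, if_false]
      have key : ∀ t, v <+: u ++ t ↔ v <+: u := fun t =>
        ⟨fun hp => (List.prefix_or_prefix_of_prefix hp (List.prefix_append u t)).resolve_right h,
          fun hp => hp.trans (List.prefix_append u t)⟩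
      rw [key, key]
    · simp [h, h']

open Classical in
theorem graftEquiv_append (u : List X) (a : TreeAut X) (w : List X) :
    graftEquiv u a (u ++ w) = u ++ a w := by
  change (if u <+: u ++ w then u ++ a ((u ++ w).drop u.length) else u ++ w) = _
  simp

open Classical in
theorem graftEquiv_of_not_prefix {u v : List X} (a : TreeAut X) (h : ¬ u <+: v) :
    graftEquiv u a v = v := by
  change (if u <+: v then u ++ a (v.drop u.length) else v) = _
  simp [h]

/-- Two automorphisms agree if they agree on the subtree below `u` and off this subtree. -/
theorem ext_of_subtree {g h : TreeAut X} (u : List X) (h1 : ∀ w, g (u ++ w) = h (u ++ w))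
    (h2 : ∀ v, ¬ u <+: v → g v = h v) : g = h := by
  ext1 v
  by_cases hv : u <+: v
  · obtain ⟨w, rfl⟩ := hv
    exact h1 w
  · exact h2 v hv

/-- The embedding of `Aut(X^*)` into itself that lets an automorphism act on the subtree below the
vertex `u`. It maps `K` onto `copies K {u}`. -/
noncomputable def graft (u : List X) : TreeAut X →* TreeAut X where
  toFun := graftEquiv u
  map_one' := ext_of_subtree u (fun w => by rw [graftEquiv_append]; rfl)
    fun v hv => graftEquiv_of_not_prefix _ hv
  map_mul' a b := ext_of_subtree u
    (fun w => by rw [graftEquiv_append, RelIso.mul_apply, RelIso.mul_apply, graftEquiv_append,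
      graftEquiv_append])
    fun v hv => by rw [RelIso.mul_apply, graftEquiv_of_not_prefix _ hv,
      graftEquiv_of_not_prefix _ hv, graftEquiv_of_not_prefix _ hv]

@[simp]
theorem graft_apply_append (u : List X) (a : TreeAut X) (w : List X) :
    graft u a (u ++ w) = u ++ a w := graftEquiv_append u a w

theorem graft_apply_of_not_prefix {u v : List X} (a : TreeAut X) (h : ¬ u <+: v) :
    graft u a v = v := graftEquiv_of_not_prefix a h

@[simp]
theorem graft_apply_self (u : List X) (a : TreeAut X) : graft u a u = u := by
  have h := graft_apply_append u a []
  have h' : a [] = [] := List.length_eq_zero_iff.1 (by simp)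
  rwa [h', List.append_nil] at h

@[simp]
theorem sectionAt_graft_self (u : List X) (a : TreeAut X) : sectionAt (graft u a) u = a :=
  sectionAt_unique fun w => by rw [graft_apply_append, graft_apply_self]

theorem graft_injective (u : List X) : Function.Injective (graft u) := fun a b h => by
  rw [← sectionAt_graft_self u a, h, sectionAt_graft_self]

theorem graft_append (u v : List X) (a : TreeAut X) : graft (u ++ v) a = graft u (graft v a) := by
  refine ext_of_subtree u (fun w => ?_) fun w hw => ?_
  · rw [graft_apply_append]
    by_cases h : v <+: w
    · obtain ⟨w, rfl⟩ := h
      rw [graft_apply_append, ← List.append_assoc, graft_apply_append, List.append_assoc]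
    · rw [graft_apply_of_not_prefix _ h, graft_apply_of_not_prefix]
      rwa [List.prefix_append_right_inj]
  · rw [graft_apply_of_not_prefix _ hw, graft_apply_of_not_prefix]
    exact fun h => hw ((List.prefix_append u v).trans h)

theorem conj_graft (g : TreeAut X) (u : List X) (a : TreeAut X) :
    g * graft u a * g⁻¹ = graft (g u) (sectionAt g u * a * (sectionAt g u)⁻¹) := by
  rw [mul_inv_eq_iff_eq_mul]
  refine ext_of_subtree u (fun w => ?_) fun v hv => ?_
  · rw [RelIso.mul_apply, RelIso.mul_apply, graft_apply_append, apply_append, apply_append,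
      graft_apply_append]
    simp [RelIso.mul_apply]
  · rw [RelIso.mul_apply, RelIso.mul_apply, graft_apply_of_not_prefix _ hv,
      graft_apply_of_not_prefix]
    rwa [prefix_apply_iff]

theorem sectionAt_eq_one {g : TreeAut X} {u : List X} (h : ∀ w, g (u ++ w) = u ++ w) :
    sectionAt g u = 1 :=
  sectionAt_unique fun w => by
    have hu : g u = u := by simpa using h []
    rw [h, hu]; rfl

theorem apply_append_of_sectionAt_eq_one {g : TreeAut X} {u : List X} (h : g u = u)
    (h1 : sectionAt g u = 1) (w : List X) : g (u ++ w) = u ++ w := by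
  rw [apply_append, h, h1]; rfl

/-- An automorphism that fixes the subtree below `u` commutes with those supported there. -/
theorem commute_graft {g : TreeAut X} {u : List X} (h : ∀ w, g (u ++ w) = u ++ w)
    (a : TreeAut X) : g * graft u a = graft u a * g := by
  have hu : g u = u := by simpa using h []
  have := conj_graft g u a
  rwa [sectionAt_eq_one h, hu, one_mul, inv_one, mul_one, mul_inv_eq_iff_eq_mul] at this

theorem graft_apply_append_of_ne {u v : List X} (a : TreeAut X) (hl : u.length = v.length)
    (h : u ≠ v) (w : List X) : graft u a (v ++ w) = v ++ w :=
  graft_apply_of_not_prefix _ fun hp =>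
    not_prefix_of_length_eq hl h (List.prefix_of_prefix_length_le hp (List.prefix_append v w) hl.le)

/-- The commutator trick for branch groups: if `g` moves `u`, then a double commutator with
automorphisms supported below `u` is again supported there and no longer involves `g`. -/
theorem commutator_commutator_graft {g : TreeAut X} {u : List X} (h : g u ≠ u)
    (a b : TreeAut X) : ⁅⁅graft u a, g⁆, graft u b⁆ = graft u ⁅a, b⁆ := by
  set c := g * graft u a * g⁻¹ with hc
  have h1 : c⁻¹ * graft u b = graft u b * c⁻¹ := by
    refine commute_graft (fun w => ?_) b
    rw [hc, conj_graft, ← map_inv]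
    exact graft_apply_append_of_ne _ (by simp) h w
  have h2 : ⁅graft u a, g⁆ = graft u a * c⁻¹ := by
    rw [hc, commutatorElement_def]; group
  rw [h2, map_commutatorElement, commutatorElement_def, commutatorElement_def, mul_inv_rev,
    inv_inv]
  calc graft u a * c⁻¹ * graft u b * (c * (graft u a)⁻¹) * (graft u b)⁻¹
      = graft u a * (c⁻¹ * graft u b) * (c * (graft u a)⁻¹) * (graft u b)⁻¹ := by group
    _ = _ := by rw [h1]; group

/-! ### Groups of automorphisms with prescribed support -/

theorem ne_one_iff_exists_apply_ne {g : TreeAut X} : g ≠ 1 ↔ ∃ u, g u ≠ u := by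
  constructor
  · intro h
    by_contra! h'
    exact h (RelIso.ext h')
  · rintro ⟨u, hu⟩ rfl
    exact hu rfl

theorem graft_mem_copies_singleton {K : Subgroup (TreeAut X)} (u : List X) {k : TreeAut X}
    (hk : k ∈ K) : graft u k ∈ copies K {u} := by
  refine ⟨fun v hv => graft_apply_of_not_prefix _ (hv u rfl), ?_⟩
  rintro y rfl
  exact ⟨by simp, by simpa using hk⟩

/-- If `V` is a finite set of incomparable vertices, `K^V` is generated by the groups `K^{v}`. -/
theorem copies_le_of_graft_mem {K A : Subgroup (TreeAut X)} {V : Set (List X)} (hV : IsLeafSet V)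
    (h : ∀ v ∈ V, ∀ k ∈ K, graft v k ∈ A) : copies K V ≤ A := by
  obtain ⟨hfin, hV⟩ := hV
  induction V, hfin using Set.Finite.induction_on with
  | empty =>
    intro g hg
    rw [show g = 1 from RelIso.ext fun u => hg.1 u (by simp)]
    exact A.one_mem
  | @insert v V hv _ ih =>
    intro g hg
    obtain ⟨hgv, hgs⟩ := hg.2 v (Set.mem_insert _ _)
    have hinc : ∀ y ∈ V, ¬ v <+: y := fun y hy =>
      hV v (Set.mem_insert _ _) y (Set.mem_insert_of_mem _ hy) (fun h => hv (h ▸ hy))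
    have hinc' : ∀ y ∈ V, ¬ y <+: v := fun y hy =>
      hV y (Set.mem_insert_of_mem _ hy) v (Set.mem_insert _ _) (fun h => hv (h ▸ hy))
    have hsub : ∀ y ∈ V, ∀ a w, graft v a (y ++ w) = y ++ w := by
      intro y hy a w
      refine graft_apply_of_not_prefix _ fun hp => ?_
      rcases List.prefix_or_prefix_of_prefix hp (List.prefix_append y w) with h1 | h1
      · exact hinc y hy h1
      · exact hinc' y hy h1
    have h1 : g * graft v (sectionAt g v)⁻¹ ∈ A := by
      refine ih (fun y hy => h y (Set.mem_insert_of_mem _ hy)) (fun _ hx _ hy =>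
        hV _ (Set.mem_insert_of_mem _ hx) _ (Set.mem_insert_of_mem _ hy)) ⟨fun u hu => ?_, ?_⟩
      · by_cases hvu : v <+: u
        · obtain ⟨w, rfl⟩ := hvu
          rw [RelIso.mul_apply, graft_apply_append, apply_append, hgv, RelIso.apply_inv_self]
        · rw [RelIso.mul_apply, graft_apply_of_not_prefix _ hvu]
          refine hg.1 u ?_
          rintro y (rfl | hy)
          exacts [hvu, hu y hy]
      · intro y hy
        have hy' := hg.2 y (Set.mem_insert_of_mem _ hy)
        have hfy : graft v (sectionAt g v)⁻¹ y = y := by simpa using hsub y hy (sectionAt g v)⁻¹ []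
        rw [RelIso.mul_apply, hfy, sectionAt_mul, hfy, sectionAt_eq_one (hsub y hy _), mul_one]
        exact hy'
    have h2 := A.mul_mem h1 (h v (Set.mem_insert _ _) _ hgs)
    rwa [map_inv, inv_mul_cancel_right] at h2

theorem isLeafSet_of_subset_level [Finite X] {n : ℕ} {V : Set (List X)} (h : V ⊆ level X n) :
    IsLeafSet V :=
  ⟨(List.finite_length_eq X n).subset h, fun _ hx _ hy hne =>
    not_prefix_of_length_eq ((h hx).trans (h hy).symm) hne⟩

theorem copies_mono_of_subset_level {K : Subgroup (TreeAut X)} {n : ℕ} {V W : Set (List X)}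
    (hVW : V ⊆ W) (hW : W ⊆ level X n) : copies K V ≤ copies K W := by
  intro g hg
  refine ⟨fun u hu => hg.1 u fun y hy => hu y (hVW hy), fun y hy => ?_⟩
  by_cases hyV : y ∈ V
  · exact hg.2 y hyV
  · have hfix : ∀ w, g (y ++ w) = y ++ w := fun w => hg.1 _ fun v hv hp => by
      have hl : v.length = y.length := (hW (hVW hv)).trans (hW hy).symm
      have := List.prefix_of_prefix_length_le hp (List.prefix_append y w) hl.le
      exact hyV (this.eq_of_length hl ▸ hv)
    refine ⟨by simpa using hfix [], ?_⟩
    rw [sectionAt_eq_one hfix]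
    exact K.one_mem

end TreeGroup

/-! ### Subgroups of finite index -/

namespace TreeGroup

section Group

variable {A B : Type*} [Group A] [Group B]

/-- The converse of `exists_cover`; the translates of `H` need not be by elements of `K`. -/
theorem relIndex_le_of_cover {H K : Subgroup A} (F : Finset A)
    (h : ∀ k ∈ K, ∃ t ∈ F, t⁻¹ * k ∈ H) : H.relIndex K ≠ 0 ∧ H.relIndex K ≤ F.card := by
  choose! r hrF hr using h
  have hinj : Function.Injective
      (fun q : K ⧸ H.subgroupOf K => (⟨r q.out, hrF _ q.out.2⟩ : F)) := by
    intro p q hpq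
    have hpq' : r p.out = r q.out := congrArg Subtype.val hpq
    rw [← p.out_eq, ← q.out_eq]
    refine QuotientGroup.eq.2 (Subgroup.mem_subgroupOf.2 ?_)
    have := H.mul_mem (H.inv_mem (hr _ p.out.2)) (hr _ q.out.2)
    rw [← hpq'] at this
    simpa using this
  have : Finite (K ⧸ H.subgroupOf K) := Finite.of_injective _ hinj
  refine ⟨Subgroup.index_ne_zero_of_finite, ?_⟩
  have hle : Nat.card (K ⧸ H.subgroupOf K) ≤ Nat.card F := Nat.card_le_card_of_injective _ hinj
  rwa [Nat.card_eq_fintype_card (α := F), Fintype.card_coe] at hle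

theorem exists_cover {H K : Subgroup A} (h : H.relIndex K ≠ 0) :
    ∃ F : Finset A, F.card ≤ H.relIndex K ∧ (∀ t ∈ F, t ∈ K) ∧ ∀ k ∈ K, ∃ t ∈ F, t⁻¹ * k ∈ H := by
  classical
  have : Finite (K ⧸ H.subgroupOf K) := Subgroup.index_ne_zero_iff_finite.1 h
  have := Fintype.ofFinite (K ⧸ H.subgroupOf K)
  refine ⟨Finset.univ.image fun q : K ⧸ H.subgroupOf K => (q.out : A), ?_, ?_, ?_⟩
  · refine Finset.card_image_le.trans ?_
    rw [Finset.card_univ, ← Nat.card_eq_fintype_card]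
    rfl
  · simp only [Finset.mem_image]
    rintro t ⟨q, -, rfl⟩
    exact q.out.2
  · intro k hk
    refine ⟨_, Finset.mem_image_of_mem _ (Finset.mem_univ ((⟨k, hk⟩ : K) : K ⧸ H.subgroupOf K)), ?_⟩
    have := QuotientGroup.eq.1 (Quotient.out_eq ((⟨k, hk⟩ : K) : K ⧸ H.subgroupOf K))
    exact Subgroup.mem_subgroupOf.1 this

/-- The index of `H` in `K` is at most the product of the indices of the images and of the kernels
under a homomorphism. -/
theorem relIndex_le_of_map_of_ker (f : A →* B) {H K : Subgroup A} (hHK : H ≤ K)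
    (h1 : (H.map f).relIndex (K.map f) ≠ 0) (h2 : (H ⊓ f.ker).relIndex (K ⊓ f.ker) ≠ 0) :
    H.relIndex K ≠ 0 ∧ H.relIndex K ≤
      (H.map f).relIndex (K.map f) * (H ⊓ f.ker).relIndex (K ⊓ f.ker) := by
  classical
  obtain ⟨F1, hc1, hF1, hF1'⟩ := exists_cover h1
  obtain ⟨F2, hc2, hF2, hF2'⟩ := exists_cover h2
  choose! l hlK hl using hF1
  have h := relIndex_le_of_cover (H := H) (K := K) (Finset.image₂ (fun t n => l t * n) F1 F2) ?_
  · exact ⟨h.1, h.2.trans ((Finset.card_image₂_le _ _ _).trans (Nat.mul_le_mul hc1 hc2))⟩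
  intro k hk
  obtain ⟨t, ht, x, hx, hxt⟩ := hF1' (f k) (Subgroup.mem_map_of_mem f hk)
  have hker : (l t)⁻¹ * k * x⁻¹ ∈ K ⊓ f.ker := by
    refine ⟨K.mul_mem (K.mul_mem (K.inv_mem (hlK t ht)) hk) (K.inv_mem (hHK hx)), ?_⟩
    change f _ = 1
    rw [map_mul, map_mul, map_inv, map_inv, hl t ht, hxt]
    group
  obtain ⟨n, hn, hn'⟩ := hF2' _ hker
  refine ⟨l t * n, Finset.mem_image₂_of_mem ht hn, ?_⟩
  have := H.mul_mem hn'.1 hx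
  convert this using 1
  group

theorem relIndex_map_ne_zero (f : A →* B) {H K : Subgroup A} (h : H.relIndex K ≠ 0) :
    (H.map f).relIndex (K.map f) ≠ 0 := by
  classical
  obtain ⟨F, -, -, hF⟩ := exists_cover h
  refine (relIndex_le_of_cover (F.image f) ?_).1
  rintro _ ⟨k, hk, rfl⟩
  obtain ⟨t, ht, htk⟩ := hF k hk
  exact ⟨f t, Finset.mem_image_of_mem f ht, t⁻¹ * k, htk, by simp⟩

theorem fg_of_relIndex_ne_zero {H K : Subgroup A} (hHK : H ≤ K) (h : H.relIndex K ≠ 0)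
    (hH : H.FG) : K.FG := by
  obtain ⟨F, -, hFK, hF⟩ := exists_cover h
  have : K = H ⊔ Subgroup.closure F := by
    refine le_antisymm (fun k hk => ?_) (sup_le hHK ((Subgroup.closure_le _).2 hFK))
    obtain ⟨t, ht, htk⟩ := hF k hk
    rw [← mul_inv_cancel_left t k]
    exact mul_mem (Subgroup.mem_sup_right (Subgroup.subset_closure ht))
      (Subgroup.mem_sup_left htk)
  rw [this]
  exact hH.sup ⟨F, rfl⟩

theorem fg_map (f : A →* B) {K : Subgroup A} (h : K.FG) : (K.map f).FG := by
  rw [Subgroup.fg_iff_submonoid_fg] at h ⊢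
  exact h.map f

theorem fg_of_le_of_relIndex_ne_zero {H K : Subgroup A} (hHK : H ≤ K) (h : H.relIndex K ≠ 0)
    (hK : K.FG) : H.FG := by
  have := (Group.fg_iff_subgroup_fg K).2 hK
  have : (H.subgroupOf K).FiniteIndex := ⟨h⟩
  have h1 : (H.subgroupOf K).FG :=
    (Group.fg_iff_subgroup_fg _).1 (Subgroup.fg_of_index_ne_zero (H.subgroupOf K))
  have h2 := fg_map K.subtype h1
  rwa [Subgroup.subgroupOf_map_subtype, inf_eq_left.2 hHK] at h2

theorem fg_of_map_of_ker (f : A →* B) {K : Subgroup A} (h1 : (K.map f).FG)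
    (h2 : (K ⊓ f.ker).FG) : K.FG := by
  obtain ⟨S, hS⟩ := h1
  have hsub : (S : Set B) ⊆ f '' K := by
    rw [← Subgroup.coe_map, ← hS]
    exact Subgroup.subset_closure
  obtain ⟨T, hTK, hT, hTS⟩ := Set.exists_subset_image_finite_and.1
    ⟨(S : Set B), hsub, S.finite_toSet, rfl⟩
  have : K = Subgroup.closure T ⊔ (K ⊓ f.ker) := by
    refine le_antisymm (fun k hk => ?_) (sup_le ((Subgroup.closure_le _).2 hTK) inf_le_left)
    have hk' : f k ∈ (Subgroup.closure T).map f := by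
      rw [MonoidHom.map_closure, ← hTS, hS]
      exact Subgroup.mem_map_of_mem f hk
    obtain ⟨t, ht, htk⟩ := hk'
    rw [← mul_inv_cancel_left t k]
    refine mul_mem (Subgroup.mem_sup_left ht) (Subgroup.mem_sup_right ⟨K.mul_mem (K.inv_mem
      ((Subgroup.closure_le K).2 hTK ht)) hk, ?_⟩)
    change f _ = 1
    rw [map_mul, map_inv, htk, inv_mul_cancel]
  rw [this]
  exact Subgroup.FG.sup ((Subgroup.fg_iff _).2 ⟨T, rfl, hT⟩) h2

instance finite_monoidHom [Group.FG A] [Finite B] : Finite (A →* B) := by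
  obtain ⟨S, hS⟩ := Group.fg_def.1 ‹Group.FG A›
  refine Finite.of_injective (fun (f : A →* B) (s : S) => f s) fun f g hfg => ?_
  refine MonoidHom.eq_of_eqOn_top fun x hx => ?_
  rw [← hS] at hx
  exact MonoidHom.eqOn_closure (fun s hs => congrFun hfg ⟨s, hs⟩) hx

/-- The action on the cosets of `H`, as an action on a set with `c` elements. -/
theorem exists_hom_ker_eq_normalCore {H : Subgroup A} {c : ℕ} (h0 : H.index ≠ 0)
    (hc : H.index ≤ c) : ∃ ψ : A →* Equiv.Perm (Fin c), ψ.ker = H.normalCore := by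
  have : Finite (A ⧸ H) := Subgroup.index_ne_zero_iff_finite.1 h0
  obtain ⟨e⟩ : Nonempty ((A ⧸ H) ↪ Fin c) :=
    ⟨(Finite.equivFin _).toEmbedding.trans (Fin.castLEEmb hc)⟩
  refine ⟨(Equiv.Perm.viaEmbeddingHom e).comp (MulAction.toPermHom A (A ⧸ H)), ?_⟩
  rw [Subgroup.normalCore_eq_ker]
  ext k
  rw [MonoidHom.mem_ker, MonoidHom.mem_ker, MonoidHom.comp_apply,
    ← map_one (Equiv.Perm.viaEmbeddingHom e), (Equiv.Perm.viaEmbeddingHom_injective e).eq_iff]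

/-- A finitely generated group `H` has finitely many subgroups of finite index such that every
group that contains `H` with index at most `c` normalizes one of them. -/
theorem exists_finite_normalized {H : Subgroup A} (hH : H.FG) (c : ℕ) :
    ∃ 𝒩 : Set (Subgroup A), 𝒩.Finite ∧ (∀ N ∈ 𝒩, N ≤ H ∧ N.relIndex H ≠ 0) ∧
      ∀ K : Subgroup A, H ≤ K → H.relIndex K ≠ 0 → H.relIndex K ≤ c →
        ∃ N ∈ 𝒩, K ≤ Subgroup.normalizer (N : Set A) := by
  have := (Group.fg_iff_subgroup_fg H).2 hH
  refine ⟨Set.range fun φ : H →* Equiv.Perm (Fin c) => φ.ker.map H.subtype, Set.finite_range _,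
    ?_, fun K hHK h0 hc => ?_⟩
  · rintro _ ⟨φ, rfl⟩
    refine ⟨Subgroup.map_subtype_le _, ?_⟩
    change (Subgroup.subgroupOf _ _).index ≠ 0
    rw [Subgroup.subgroupOf, Subgroup.comap_map_eq_self_of_injective H.subtype_injective,
      Subgroup.index_ker]
    exact Nat.card_pos.ne'
  obtain ⟨ψ, hψ⟩ := exists_hom_ker_eq_normalCore (H := H.subgroupOf K) h0 hc
  refine ⟨_, ⟨ψ.comp (Subgroup.inclusion hHK), rfl⟩, ?_⟩
  have hker : ((ψ.comp (Subgroup.inclusion hHK)).ker.map H.subtype) = ψ.ker.map K.subtype := by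
    ext a
    constructor
    · rintro ⟨x, hx, rfl⟩
      exact ⟨Subgroup.inclusion hHK x, hx, rfl⟩
    · rintro ⟨x, hx, rfl⟩
      have hx' : x ∈ H.subgroupOf K := Subgroup.normalCore_le _ (hψ ▸ hx)
      exact ⟨⟨x, hx'⟩, hx, rfl⟩
  change K ≤ Subgroup.normalizer ((ψ.comp (Subgroup.inclusion hHK)).ker.map H.subtype : Set A)
  rw [hker, Subgroup.le_normalizer_iff]
  rintro k hk _ ⟨x, hx, rfl⟩
  have hconj : ⟨k, hk⟩ * x * ⟨k, hk⟩⁻¹ ∈ ψ.ker := Subgroup.Normal.conj_mem inferInstance x hx _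
  exact ⟨_, hconj, rfl⟩

theorem finite_setOf_between {N K : Subgroup A} (h : N.relIndex K ≠ 0) :
    {M : Subgroup A | N ≤ M ∧ M ≤ K}.Finite := by
  classical
  obtain ⟨F, -, -, hF⟩ := exists_cover h
  refine Set.Finite.of_finite_image (f := fun M : Subgroup A => F.filter (· ∈ M))
    ((Set.finite_Iic F).subset ?_) ?_
  · rintro _ ⟨M, -, rfl⟩
    exact Finset.filter_subset _ _
  · have key : ∀ M M' : Subgroup A, N ≤ M → M ≤ K → N ≤ M' →
        F.filter (· ∈ M) = F.filter (· ∈ M') → M ≤ M' := by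
      intro M M' hNM hMK hNM' heq k hk
      obtain ⟨t, ht, htk⟩ := hF k (hMK hk)
      have htM : t ∈ M := by
        have := M.mul_mem hk (M.inv_mem (hNM htk))
        simpa using this
      have htM' : t ∈ M' := by
        have : t ∈ F.filter (· ∈ M') := heq ▸ Finset.mem_filter.2 ⟨ht, htM⟩
        exact (Finset.mem_filter.1 this).2
      simpa using M'.mul_mem htM' (hNM' htk)
    intro M hM M' hM' heq
    exact le_antisymm (key _ _ hM.1 hM.2 hM'.1 heq) (key _ _ hM'.1 hM'.2 hM.1 heq.symm)

theorem exists_normalized_finiteIndexIn {J G : Subgroup A} (h : FiniteIndexIn J G) :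
    ∃ J₀ ≤ J, FiniteIndexIn J₀ G ∧ G ≤ Subgroup.normalizer (J₀ : Set A) := by
  have hfi : (J.subgroupOf G).FiniteIndex := ⟨h.2⟩
  have hle : ((J.subgroupOf G).normalCore).map G.subtype ≤ J := by
    rintro _ ⟨x, hx, rfl⟩
    exact Subgroup.mem_subgroupOf.1 (Subgroup.normalCore_le _ hx)
  refine ⟨_, hle, ⟨hle.trans h.1, ?_⟩, ?_⟩
  · change (Subgroup.subgroupOf _ _).index ≠ 0
    rw [Subgroup.subgroupOf, Subgroup.comap_map_eq_self_of_injective G.subtype_injective]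
    exact Subgroup.FiniteIndex.index_ne_zero
  · rw [Subgroup.le_normalizer_iff]
    rintro k hk _ ⟨x, hx, rfl⟩
    have hconj : ⟨k, hk⟩ * x * ⟨k, hk⟩⁻¹ ∈ (J.subgroupOf G).normalCore :=
      Subgroup.Normal.conj_mem inferInstance x hx _
    exact ⟨_, hconj, rfl⟩

theorem JustInfinite.relIndex_ne_zero {G N : Subgroup A} (hG : JustInfinite G) (hNG : N ≤ G)
    (hN : G ≤ Subgroup.normalizer (N : Set A)) (hne : N ≠ ⊥) : N.relIndex G ≠ 0 := by
  refine Subgroup.index_ne_zero_iff_finite.2 (hG.2 _ ?_ ?_)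
  · exact (Subgroup.normal_subgroupOf_iff_le_normalizer hNG).2 hN
  · intro h
    rw [Subgroup.subgroupOf_eq_bot] at h
    exact hne (le_bot_iff.1 (h le_rfl hNG))

theorem infinite_of_finiteIndexIn {G J : Subgroup A} [Infinite G] (h : FiniteIndexIn J G) :
    Infinite J := by
  by_contra hfin
  rw [not_infinite_iff_finite] at hfin
  have : Finite (G ⧸ J.subgroupOf G) := Subgroup.index_ne_zero_iff_finite.1 h.2
  have : Finite (J.subgroupOf G) := (Subgroup.subgroupOfEquivOfLe h.1).toEquiv.finite_iff.2 hfin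
  have : Finite G := Subgroup.finite_iff_finite_and_finiteIndex (J.subgroupOf G) |>.2 ⟨‹_›, ⟨h.2⟩⟩
  exact not_finite G

end Group

end TreeGroup

/-! ### Branching in a just infinite group -/

namespace TreeGroup

variable {X : Type*}

/-- A nontrivial subgroup `K` of `G` that is normalized by `G` and contains `K^{u}` for all
vertices `u`. No finiteness of indices is required, so that the commutator subgroup of `K` has these
properties again; in a just infinite group the indices are finite. -/
structure IsGraftCore (G K : Subgroup (TreeAut X)) : Prop where
  le : K ≤ G
  le_normalizer : G ≤ Subgroup.normalizer (K : Set (TreeAut X))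
  graft_mem : ∀ u, ∀ k ∈ K, graft u k ∈ K
  ne_bot : K ≠ ⊥

theorem conj_mem_of_le_normalizer {A : Type*} [Group A] {H K : Subgroup A}
    (h : H ≤ Subgroup.normalizer (K : Set A)) {g k : A} (hg : g ∈ H) (hk : k ∈ K) :
    g * k * g⁻¹ ∈ K :=
  Subgroup.le_normalizer_iff.1 h g hg k hk

theorem commutator_mem_of_le_normalizer {A : Type*} [Group A] {H K : Subgroup A}
    (h : H ≤ Subgroup.normalizer (K : Set A)) {g k : A} (hg : g ∈ H) (hk : k ∈ K) :
    ⁅g, k⁆ ∈ K :=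
  K.mul_mem (conj_mem_of_le_normalizer h hg hk) (K.inv_mem hk)

namespace IsGraftCore

variable {G K : Subgroup (TreeAut X)}

theorem exists_not_commute (hK : IsGraftCore G K) : ∃ a ∈ K, ∃ b ∈ K, ⁅a, b⁆ ≠ 1 := by
  obtain ⟨g, hg, hg1⟩ := (Subgroup.bot_or_exists_ne_one K).resolve_left hK.ne_bot
  obtain ⟨u, hu⟩ := ne_one_iff_exists_apply_ne.1 hg1
  refine ⟨g, hg, graft u g, hK.graft_mem u g hg, fun h => ?_⟩
  rw [commutatorElement_def, mul_inv_eq_one, conj_graft] at h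
  have h1 := graft_apply_append u g u
  rw [← h, graft_apply_append_of_ne _ (by simp) hu] at h1
  exact hu (List.append_cancel_left h1).symm

theorem commutator (hK : IsGraftCore G K) : IsGraftCore G ⁅K, K⁆ where
  le := K.commutator_le_self.trans hK.le
  le_normalizer := by
    rw [Subgroup.le_normalizer_iff]
    intro g hg k hk
    have h1 : K.map (MulAut.conj g).toMonoidHom ≤ K := by
      rintro _ ⟨x, hx, rfl⟩
      exact conj_mem_of_le_normalizer hK.le_normalizer hg hx
    have h2 : (⁅K, K⁆ : Subgroup (TreeAut X)).map (MulAut.conj g).toMonoidHom ≤ ⁅K, K⁆ := by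
      rw [Subgroup.map_commutator]
      exact Subgroup.commutator_mono h1 h1
    exact h2 ⟨k, hk, rfl⟩
  graft_mem u k hk := by
    have h1 : K.map (graft u) ≤ K := by
      rintro _ ⟨x, hx, rfl⟩
      exact hK.graft_mem u x hx
    have h2 : (⁅K, K⁆ : Subgroup (TreeAut X)).map (graft u) ≤ ⁅K, K⁆ := by
      rw [Subgroup.map_commutator]
      exact Subgroup.commutator_mono h1 h1
    exact h2 ⟨k, hk, rfl⟩
  ne_bot h := by
    obtain ⟨a, ha, b, hb, hab⟩ := hK.exists_not_commute
    exact hab ((Subgroup.eq_bot_iff_forall _).1 h _ (Subgroup.commutator_mem_commutator ha hb))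

/-- A group normalized by `K^{u}` that moves `u` contains the commutator subgroup of `K^{u}`. -/
theorem graft_mem_of_moved {A J : Subgroup (TreeAut X)} {u : List X}
    (hA : J ≤ Subgroup.normalizer (A : Set (TreeAut X))) (hJ : ∀ k ∈ K, graft u k ∈ J)
    {g : TreeAut X} (hg : g ∈ A) (hgu : g u ≠ u) {k : TreeAut X}
    (hk : k ∈ (⁅K, K⁆ : Subgroup (TreeAut X))) : graft u k ∈ A := by
  have : (⁅K, K⁆ : Subgroup (TreeAut X)) ≤ A.comap (graft u) := by
    refine Subgroup.commutator_le.2 fun a ha b hb => ?_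
    rw [Subgroup.mem_comap, ← commutator_commutator_graft hgu]
    rw [← inv_mem_iff, commutatorElement_inv]
    exact commutator_mem_of_le_normalizer hA (hJ b hb)
      (commutator_mem_of_le_normalizer hA (hJ a ha) hg)
  exact this hk

theorem graft_apply_mem (hG : IsSelfSimilar G) (hK : IsGraftCore G K) {A J : Subgroup (TreeAut X)}
    (hJG : J ≤ G) (hA : J ≤ Subgroup.normalizer (A : Set (TreeAut X))) {u : List X}
    (hu : ∀ k ∈ K, graft u k ∈ A) {j : TreeAut X} (hj : j ∈ J) :
    ∀ k ∈ K, graft (j u) k ∈ A := by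
  intro k hk
  set s := sectionAt j u
  have hs : s⁻¹ * k * s ∈ K := by
    have := conj_mem_of_le_normalizer hK.le_normalizer (G.inv_mem (hG j (hJG hj) u)) hk
    simpa using this
  have := conj_mem_of_le_normalizer hA hj (hu _ hs)
  rw [conj_graft] at this
  convert this using 2
  simp only [s]
  group

theorem copies_le [Finite X] (hK : IsGraftCore G K) (n : ℕ) : copies K (level X n) ≤ K :=
  copies_le_of_graft_mem (isLeafSet_of_subset_level subset_rfl) fun v _ k hk => hK.graft_mem v k hk

end IsGraftCore

theorem le_normalizer_copies {G K H : Subgroup (TreeAut X)} (hG : IsSelfSimilar G) (hHG : H ≤ G)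
    (hK : G ≤ Subgroup.normalizer (K : Set (TreeAut X))) {Y : Set (List X)}
    (hY : ∀ h ∈ H, ∀ y ∈ Y, h y ∈ Y) : H ≤ Subgroup.normalizer (copies K Y : Set (TreeAut X)) := by
  rw [Subgroup.le_normalizer_iff]
  intro h hh g hg
  refine ⟨fun u hu => ?_, fun y hy => ?_⟩
  · have : g (h⁻¹ u) = h⁻¹ u := hg.1 _ fun y hy hp => by
      refine hu _ (hY h hh y hy) ?_
      rwa [← prefix_apply_iff h⁻¹, RelIso.inv_apply_self]
    rw [RelIso.mul_apply, RelIso.mul_apply, this, RelIso.apply_inv_self]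
  · obtain ⟨h1, h2⟩ := hg.2 _ (hY _ (H.inv_mem hh) y hy)
    refine ⟨?_, ?_⟩
    · rw [RelIso.mul_apply, RelIso.mul_apply, h1, RelIso.apply_inv_self]
    · have h3 := sectionAt_inv_apply h (h⁻¹ y)
      rw [RelIso.apply_inv_self] at h3
      rw [sectionAt_mul, sectionAt_mul, h1, h3]
      exact conj_mem_of_le_normalizer hK (hG h (hHG hh) _) h2

section JustInfinite

variable {G K : Subgroup (TreeAut X)}

theorem IsGraftCore.relIndex_ne_zero (hji : JustInfinite G) (hK : IsGraftCore G K) :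
    K.relIndex G ≠ 0 :=
  hji.relIndex_ne_zero hK.le hK.le_normalizer hK.ne_bot

theorem nonempty_of_infinite [Infinite G] : Nonempty X := by
  by_contra h
  rw [not_nonempty_iff] at h
  have : Subsingleton (TreeAut X) := ⟨fun a b => RelIso.ext fun u => Subsingleton.elim _ _⟩
  exact not_finite G

/-- `J` is a normal subgroup of finite index of `G` that contains `K^{u}` for all vertices `u` of
level at least `m`, and acts transitively on each level of the subtree below each vertex of
level `m`. -/
structure IsBase (G K J : Subgroup (TreeAut X)) (m : ℕ) : Prop where
  le : J ≤ G
  le_normalizer : G ≤ Subgroup.normalizer (J : Set (TreeAut X))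
  graft_mem : ∀ u : List X, m ≤ u.length → ∀ k ∈ K, graft u k ∈ J
  exists_apply_eq : ∀ u v w : List X, u.length = m → v.length = w.length →
    ∃ j ∈ J, j (u ++ v) = u ++ w

/-- Each normal subgroup of finite index of `G` is transitive on the levels below each vertex of
a sufficiently high level, since its number of orbits on a level is at most its index. -/
theorem exists_isBase (hji : JustInfinite G) (hG : IsSelfSimilar G) (htr : IsLevelTransitive G)
    (hK : IsGraftCore G K) {J : Subgroup (TreeAut X)} (hJ : FiniteIndexIn J G)
    (hn : G ≤ Subgroup.normalizer (J : Set (TreeAut X))) : ∃ m, IsBase G ⁅K, K⁆ J m := by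
  have := hji.1
  obtain ⟨x⟩ := nonempty_of_infinite (G := G)
  have hJinf := infinite_of_finiteIndexIn hJ
  obtain ⟨g, hg1⟩ := exists_ne (1 : J)
  have hg1' : (g : TreeAut X) ≠ 1 := fun h => hg1 (Subtype.ext h)
  obtain ⟨u₀, hu₀⟩ := ne_one_iff_exists_apply_ne.1 hg1'
  have hfin : Finite (G ⧸ J.subgroupOf G) := Subgroup.index_ne_zero_iff_finite.1 hJ.2
  -- the cosets of `J` that meet the stabilizer of the `n`-th vertex of a ray
  let S : ℕ → Set (G ⧸ J.subgroupOf G) := fun n =>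
    {q | ∃ g : G, (g : TreeAut X) (List.replicate n x) = List.replicate n x ∧ (g : G ⧸ _) = q}
  have hS : Antitone S := by
    rintro n k hnk _ ⟨g, hg, rfl⟩
    refine ⟨g, ?_, rfl⟩
    obtain ⟨l, rfl⟩ := Nat.exists_eq_add_of_le hnk
    rw [List.replicate_add] at hg
    exact (apply_left_of_apply_append rfl hg).1
  obtain ⟨m, hm, hmin⟩ := (measure fun n => (S n).ncard).wf.has_min {n | u₀.length ≤ n}
    ⟨_, le_refl u₀.length⟩
  have hSm : ∀ k, S (m + k) = S m := fun k =>
    Set.eq_of_subset_of_ncard_le (hS (Nat.le_add_right m k))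
      (not_lt.1 (hmin (m + k) (le_trans hm (Nat.le_add_right m k)))) (Set.toFinite _)
  have hray : ∀ w : List X, ∃ j ∈ J, j (List.replicate m x ++ List.replicate w.length x) =
      List.replicate m x ++ w := by
    intro w
    obtain ⟨g, hgG, hg⟩ := htr (m + w.length) (List.replicate m x ++ List.replicate w.length x)
      (by simp [level]) (List.replicate m x ++ w) (by simp [level])
    have hgS : ((⟨g, hgG⟩ : G) : G ⧸ J.subgroupOf G) ∈ S (m + w.length) := by
      rw [hSm]
      exact ⟨_, (apply_left_of_apply_append rfl hg).1, rfl⟩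
    obtain ⟨h, hh, hhq⟩ := hgS
    have hj : (h : TreeAut X)⁻¹ * g ∈ J :=
      Subgroup.mem_subgroupOf.1 (QuotientGroup.eq.1 hhq)
    refine ⟨g * (h : TreeAut X)⁻¹, ?_, ?_⟩
    · have := conj_mem_of_le_normalizer hn h.2 hj
      simpa using this
    · rw [← hg, RelIso.mul_apply, ← List.replicate_add]
      congr 1
      conv_lhs => rw [← hh]
      exact RelIso.inv_apply_self _ _
  refine ⟨m, hJ.1, hn, fun u hu => ?_, fun u v w hu hvw => ?_⟩
  · have h0 : ∀ k ∈ (⁅K, K⁆ : Subgroup (TreeAut X)), graft u₀ k ∈ J := fun k hk =>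
      IsGraftCore.graft_mem_of_moved hn (fun a ha => hK.le (hK.graft_mem u₀ a ha)) g.2 hu₀ hk
    obtain ⟨c, hc, hcu⟩ := htr u₀.length u₀ rfl (u.take u₀.length)
      (by simp [level, le_trans hm hu])
    have h1 := hK.commutator.graft_apply_mem hG le_rfl hn h0 hc
    intro k hk
    rw [← List.take_append_drop u₀.length u, graft_append, ← hcu]
    exact h1 _ (hK.commutator.graft_mem _ k hk)
  · obtain ⟨c, hc, hcu⟩ := htr m (List.replicate m x) (by simp [level]) u hu
    have key : ∀ v : List X, ∃ j ∈ J, j (u ++ sectionAt c (List.replicate m x)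
        (List.replicate v.length x)) = u ++ v := by
      intro v
      obtain ⟨j, hj, hjv⟩ := hray ((sectionAt c (List.replicate m x))⁻¹ v)
      refine ⟨c * j * c⁻¹, conj_mem_of_le_normalizer hn hc hj, ?_⟩
      rw [← hcu, ← apply_append, RelIso.mul_apply, RelIso.mul_apply, RelIso.inv_apply_self]
      rw [length_apply] at hjv
      rw [hjv, apply_append, RelIso.apply_inv_self]
    obtain ⟨j, hj, hjv⟩ := key v
    obtain ⟨j', hj', hjw⟩ := key w
    refine ⟨j' * j⁻¹, J.mul_mem hj' (J.inv_mem hj), ?_⟩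
    rw [← hjv, RelIso.mul_apply, RelIso.inv_apply_self, hvw, hjw]

/-- The vertices of level `m` such that `A` moves a vertex below them. -/
def movedVertices (A : Subgroup (TreeAut X)) (m : ℕ) : Set (List X) :=
  {u | u.length = m ∧ ∃ w, ∃ a ∈ A, a (u ++ w) ≠ u ++ w}

theorem movedVertices_mono {A B : Subgroup (TreeAut X)} (h : A ≤ B) (m : ℕ) :
    movedVertices A m ⊆ movedVertices B m :=
  fun _ ⟨hu, w, a, ha, haw⟩ => ⟨hu, w, a, h ha, haw⟩

variable [Finite X]

theorem IsGraftCore.relIndex_copies_ne_zero (hji : JustInfinite G) (hG : IsSelfSimilar G)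
    (hK : IsGraftCore G K) (n : ℕ) : (copies K (level X n)).relIndex G ≠ 0 := by
  have := hji.1
  obtain ⟨x⟩ := nonempty_of_infinite (G := G)
  refine hji.relIndex_ne_zero ((hK.copies_le n).trans hK.le)
    (le_normalizer_copies hG le_rfl hK.le_normalizer fun g _ y hy => ?_) fun h => ?_
  · exact (length_apply g y).trans hy
  · obtain ⟨k, hk, hk1⟩ := (Subgroup.bot_or_exists_ne_one K).resolve_left hK.ne_bot
    have hmem : graft (List.replicate n x) k ∈ copies K (level X n) :=
      copies_mono_of_subset_level (V := {List.replicate n x}) (by simp [level]) subset_rfl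
        (graft_mem_copies_singleton _ hk)
    rw [h, Subgroup.mem_bot] at hmem
    exact hk1 (graft_injective _ (hmem.trans (map_one _).symm))

theorem finite_movedVertices (A : Subgroup (TreeAut X)) (m : ℕ) : (movedVertices A m).Finite :=
  (List.finite_length_eq X m).subset fun _ h => h.1

variable {J A : Subgroup (TreeAut X)} {m : ℕ}

/-- Once `A` moves a vertex below the vertex `u` of level `m`, the commutator trick provides `K'^{z}`
inside `A` for one vertex `z` below `u`, and conjugation by `J` provides it for all vertices of the
level of `z` below `u`. -/
theorem exists_graft_mem_of_movedVertices (hG : IsSelfSimilar G) (hK : IsGraftCore G K)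
    (hJ : IsBase G K J m) (hA : J ≤ Subgroup.normalizer (A : Set (TreeAut X))) :
    ∃ k, ∀ u ∈ movedVertices A m, ∀ v : List X, k ≤ v.length →
      ∀ x ∈ (⁅K, K⁆ : Subgroup (TreeAut X)), graft (u ++ v) x ∈ A := by
  have key : ∀ u ∈ movedVertices A m, ∃ k, ∀ v : List X, k ≤ v.length →
      ∀ x ∈ (⁅K, K⁆ : Subgroup (TreeAut X)), graft (u ++ v) x ∈ A := by
    rintro u ⟨hu, w, a, ha, haw⟩
    refine ⟨w.length, fun v hv x hx => ?_⟩
    have h0 : ∀ k ∈ (⁅K, K⁆ : Subgroup (TreeAut X)), graft (u ++ w) k ∈ A := fun k hk =>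
      IsGraftCore.graft_mem_of_moved hA (hJ.graft_mem _ (by simp [hu])) ha haw hk
    obtain ⟨j, hj, hjw⟩ := hJ.exists_apply_eq u w (v.take w.length) hu (by simp [hv])
    rw [← List.take_append_drop w.length v, ← List.append_assoc, graft_append, ← hjw]
    exact hK.commutator.graft_apply_mem hG hJ.le hA h0 hj _ (hK.commutator.graft_mem _ x hx)
  choose! k hk using key
  obtain ⟨N, hN⟩ := ((finite_movedVertices A m).image k).bddAbove
  exact ⟨N, fun u hu v hv => hk u hu v ((hN (Set.mem_image_of_mem k hu)).trans hv)⟩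

/-- If the moved vertices of `A'` lie in `U`, an element of `A' ⊓ K^{X^(m+k)}` is supported below
`U`, hence lies in each group containing `K^{z}` for all vertices `z` of level `m + k` below `U`. -/
theorem copies_inf_le {A' B : Subgroup (TreeAut X)} {k : ℕ} {U : Set (List X)}
    (hU : movedVertices A' m ⊆ U) (hUm : U ⊆ level X m)
    (hB : ∀ u ∈ U, ∀ v : List X, v.length = k → ∀ x ∈ K, graft (u ++ v) x ∈ B) :
    copies K (level X (m + k)) ⊓ A' ≤ B := by
  rintro g ⟨hg, hgA⟩
  have hV : {z : List X | ∃ u ∈ U, ∃ v : List X, v.length = k ∧ z = u ++ v} ⊆ level X (m + k) := by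
    rintro _ ⟨u, hu, v, hv, rfl⟩
    have := hUm hu
    simp only [level, Set.mem_ofPred_eq, List.length_append] at this ⊢
    omega
  refine copies_le_of_graft_mem (K := K) (isLeafSet_of_subset_level hV) ?_
    ⟨fun z hz => ?_, fun y hy => hg.2 y (hV hy)⟩
  · rintro _ ⟨u, hu, v, hv, rfl⟩
    exact hB u hu v hv
  · by_cases hl : m + k ≤ z.length
    · have hzm : (z.take m).length = m := by rw [List.length_take]; omega
      by_cases hzU : z.take m ∈ U
      · refine absurd ?_ (hz _ ⟨_, hzU, (z.drop m).take k, by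
          rw [List.length_take, List.length_drop]; omega, rfl⟩)
        conv_rhs => rw [← List.take_append_drop m z]
        rw [List.prefix_append_right_inj]
        exact List.take_prefix _ _
      · by_contra hne
        refine hzU (hU ⟨hzm, z.drop m, g, hgA, ?_⟩)
        rwa [List.take_append_drop]
    · refine hg.1 z fun y hy hp => hl ?_
      have := hp.length_le
      rwa [show y.length = m + k from hy] at this

/-- Up to finite index, a group normalized by `J` is determined by its moved vertices. -/
theorem exists_relIndex_le (hji : JustInfinite G) (hG : IsSelfSimilar G) (hK : IsGraftCore G K)
    (hJ : IsBase G K J m) (hA : J ≤ Subgroup.normalizer (A : Set (TreeAut X))) :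
    ∃ c, ∀ A' : Subgroup (TreeAut X), A' ≤ G → movedVertices A' m ⊆ movedVertices A m →
      A.relIndex A' ≠ 0 ∧ A.relIndex A' ≤ c := by
  obtain ⟨k, hk⟩ := exists_graft_mem_of_movedVertices hG hK hJ hA
  refine ⟨(copies ⁅K, K⁆ (level X (m + k))).relIndex G, fun A' hA' hU => ?_⟩
  have h0 := hK.commutator.relIndex_copies_ne_zero hji hG (m + k)
  have hle : copies ⁅K, K⁆ (level X (m + k)) ⊓ A' ≤ A :=
    copies_inf_le hU (fun u hu => hu.1) fun u hu v hv => hk u hu v hv.ge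
  have h1 : (copies ⁅K, K⁆ (level X (m + k)) ⊓ A').relIndex A' ≠ 0 := by
    rw [Subgroup.inf_relIndex_right]
    exact fun h => h0 (Subgroup.relIndex_eq_zero_of_le_right hA' h)
  refine ⟨fun h => h1 (Subgroup.relIndex_eq_zero_of_le_left hle h),
    (Subgroup.relIndex_le_of_le_left hle h1).trans ?_⟩
  rw [Subgroup.inf_relIndex_right]
  exact Subgroup.relIndex_le_of_le_right hA' h0

/-- A group normalized by `J` contains, with finite index, a group generated by finitely many copies
of the finitely generated group `K'`. -/
theorem fg_of_le_normalizer (hfg : G.FG) (hji : JustInfinite G) (hG : IsSelfSimilar G)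
    (hK : IsGraftCore G K) (hJ : IsBase G K J m) (hAG : A ≤ G)
    (hA : J ≤ Subgroup.normalizer (A : Set (TreeAut X))) : A.FG := by
  obtain ⟨k, hk⟩ := exists_graft_mem_of_movedVertices hG hK hJ hA
  have hK2 : (⁅K, K⁆ : Subgroup (TreeAut X)).FG :=
    fg_of_le_of_relIndex_ne_zero hK.commutator.le (hK.commutator.relIndex_ne_zero hji) hfg
  let V : Set (List X) := {z | ∃ u ∈ movedVertices A m, ∃ v : List X, v.length = k ∧ z = u ++ v}
  have hV : V.Finite := by
    refine (List.finite_length_eq X (m + k)).subset ?_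
    rintro _ ⟨u, hu, v, hv, rfl⟩
    simp [hu.1, hv]
  let Q : Subgroup (TreeAut X) := ⨆ z ∈ V, (⁅K, K⁆ : Subgroup (TreeAut X)).map (graft z)
  have hQ : Q.FG := Subgroup.FG.biSup hV _ fun z _ => fg_map _ hK2
  have hQA : Q ≤ A := by
    refine iSup₂_le ?_
    rintro _ ⟨u, hu, v, hv, rfl⟩ _ ⟨x, hx, rfl⟩
    exact hk u hu v hv.ge x hx
  refine fg_of_relIndex_ne_zero hQA (fun h => ?_) hQ
  have hle : copies ⁅K, K⁆ (level X (m + k)) ⊓ A ≤ Q :=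
    copies_inf_le (U := movedVertices A m) subset_rfl (fun u hu => hu.1) fun u hu v hv x hx =>
      (le_iSup₂_of_le (f := fun z (_ : z ∈ V) => (⁅K, K⁆ : Subgroup (TreeAut X)).map (graft z))
        (u ++ v) ⟨u, hu, v, hv, rfl⟩ le_rfl) ⟨x, hx, rfl⟩
  have := Subgroup.relIndex_eq_zero_of_le_left hle h
  rw [Subgroup.inf_relIndex_right] at this
  exact hK.commutator.relIndex_copies_ne_zero hji hG (m + k)
    (Subgroup.relIndex_eq_zero_of_le_right hAG this)

end JustInfinite

end TreeGroup

/-! ### Subgroups of finite products -/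

namespace TreeGroup

section Pi

variable {A ι : Type*} [Group A]

/-- The elements of the product whose coordinates in `s` are trivial. -/
def vanishing (A : Type*) [Group A] {ι : Type*} (s : Set ι) : Subgroup (ι → A) :=
  ⨅ i ∈ s, (Pi.evalMonoidHom (fun _ : ι => A) i).ker

theorem mem_vanishing {s : Set ι} {p : ι → A} : p ∈ vanishing A s ↔ ∀ i ∈ s, p i = 1 := by
  simp [vanishing, Subgroup.mem_iInf, MonoidHom.mem_ker]

theorem vanishing_insert (s : Set ι) (i : ι) :
    vanishing A (insert i s) = vanishing A s ⊓ (Pi.evalMonoidHom (fun _ : ι => A) i).ker := by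
  rw [vanishing, iInf_insert, inf_comm]
  rfl

/-- The `i`-th coordinates of the elements of `P` whose coordinates in `s` are trivial. -/
def coordinates (P : Subgroup (ι → A)) (s : Set ι) (i : ι) : Subgroup A :=
  (P ⊓ vanishing A s).map (Pi.evalMonoidHom (fun _ : ι => A) i)

theorem mem_coordinates {P : Subgroup (ι → A)} {s : Set ι} {i : ι} {a : A} :
    a ∈ coordinates P s i ↔ ∃ p ∈ P, (∀ j ∈ s, p j = 1) ∧ p i = a := by
  simp only [coordinates, Subgroup.mem_map, Subgroup.mem_inf, mem_vanishing, Pi.evalMonoidHom_apply,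
    and_assoc]

theorem coordinates_mono {P Q : Subgroup (ι → A)} (h : P ≤ Q) (s : Set ι) (i : ι) :
    coordinates P s i ≤ coordinates Q s i :=
  Subgroup.map_mono (inf_le_inf_right _ h)

theorem conj_mem_coordinates {P Q : Subgroup (ι → A)}
    (h : Q ≤ Subgroup.normalizer (P : Set (ι → A)))
    {s : Set ι} {i : ι} {a : A} (ha : a ∈ coordinates P s i) {q : ι → A} (hq : q ∈ Q) :
    q i * a * (q i)⁻¹ ∈ coordinates P s i := by
  obtain ⟨p, hp, hps, rfl⟩ := mem_coordinates.1 ha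
  refine mem_coordinates.2 ⟨q * p * q⁻¹, conj_mem_of_le_normalizer h hq hp, fun j hj => ?_, rfl⟩
  simp [hps j hj]

theorem compl_eq_insert_compl_insert {i : ι} {t : Set ι} (hi : i ∉ t) :
    tᶜ = insert i (insert i t)ᶜ := by
  ext j
  by_cases hj : j = i <;> simp [hj, hi]

theorem vanishing_univ : vanishing A (Set.univ : Set ι) = ⊥ := by
  rw [eq_bot_iff]
  intro p hp
  exact funext fun i => mem_vanishing.1 hp i trivial

theorem vanishing_empty : vanishing A (∅ : Set ι) = ⊤ := by
  simp [vanishing]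

/-- The filtration of a subgroup of a product by the number of trivial coordinates has the coordinate
groups as its factors. All sets `s` of coordinates are admitted, so that no enumeration of `ι` has
to be chosen. -/
theorem relIndex_le_pow_of_coordinates [Finite ι] {P Q : Subgroup (ι → A)} (hPQ : P ≤ Q) {c : ℕ}
    (h : ∀ s i, (coordinates P s i).relIndex (coordinates Q s i) ≠ 0 ∧
      (coordinates P s i).relIndex (coordinates Q s i) ≤ c) :
    P.relIndex Q ≠ 0 ∧ P.relIndex Q ≤ c ^ Nat.card ι := by
  have key : ∀ t : Set ι, (P ⊓ vanishing A tᶜ).relIndex (Q ⊓ vanishing A tᶜ) ≠ 0 ∧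
      (P ⊓ vanishing A tᶜ).relIndex (Q ⊓ vanishing A tᶜ) ≤ c ^ t.ncard := by
    intro t
    induction t, Set.toFinite t using Set.Finite.induction_on with
    | empty => simp [vanishing_univ]
    | @insert i t hi ht ih =>
      rw [compl_eq_insert_compl_insert hi, vanishing_insert, ← inf_assoc, ← inf_assoc] at ih
      obtain ⟨h1, h2⟩ := h (insert i t)ᶜ i
      obtain ⟨h3, h4⟩ := relIndex_le_of_map_of_ker (Pi.evalMonoidHom (fun _ : ι => A) i)
        (inf_le_inf_right (vanishing A (insert i t)ᶜ) hPQ) h1 ih.1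
      refine ⟨h3, h4.trans ?_⟩
      rw [Set.ncard_insert_of_notMem hi ht, pow_succ']
      exact Nat.mul_le_mul h2 ih.2
  have := key Set.univ
  rwa [Set.compl_univ, vanishing_empty, inf_top_eq, inf_top_eq, Set.ncard_univ] at this

theorem fg_of_coordinates [Finite ι] {P : Subgroup (ι → A)}
    (h : ∀ s i, (coordinates P s i).FG) : P.FG := by
  have key : ∀ t : Set ι, (P ⊓ vanishing A tᶜ).FG := by
    intro t
    induction t, Set.toFinite t using Set.Finite.induction_on with
    | empty => simpa [vanishing_univ] using Subgroup.FG.bot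
    | @insert i t hi ht ih =>
      rw [compl_eq_insert_compl_insert hi, vanishing_insert, ← inf_assoc] at ih
      exact fg_of_map_of_ker (Pi.evalMonoidHom (fun _ : ι => A) i) (h (insert i t)ᶜ i) ih
  have := key Set.univ
  rwa [Set.compl_univ, vanishing_empty, inf_top_eq] at this

end Pi

/-! ### Infra-direct products -/

variable {X : Type*}

theorem mem_stabilizerImage {H : Subgroup (TreeAut X)} {Y : Set (List X)} {p : Y → TreeAut X} :
    p ∈ stabilizerImage H Y ↔ ∃ g : fixer Y, (g : TreeAut X) ∈ H ∧ sectionHom Y g = p := by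
  simp [stabilizerImage, Subgroup.mem_map, Subgroup.mem_subgroupOf]

theorem stabilizerImage_mono {H M : Subgroup (TreeAut X)} (h : H ≤ M) (Y : Set (List X)) :
    stabilizerImage H Y ≤ stabilizerImage M Y :=
  Subgroup.map_mono (Subgroup.comap_mono h)

theorem coordinates_le {G M : Subgroup (TreeAut X)} (hG : IsSelfSimilar G) (hM : M ≤ G)
    {Y : Set (List X)} (s : Set Y) (y : Y) : coordinates (stabilizerImage M Y) s y ≤ G := by
  intro a ha
  obtain ⟨p, hp, -, rfl⟩ := mem_coordinates.1 ha
  obtain ⟨g, hg, rfl⟩ := mem_stabilizerImage.1 hp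
  exact hG _ (hM hg) _

theorem stabilizerImage_le_normalizer {M N : Subgroup (TreeAut X)}
    (h : M ≤ Subgroup.normalizer (N : Set (TreeAut X))) (Y : Set (List X)) :
    stabilizerImage M Y ≤ Subgroup.normalizer (stabilizerImage N Y : Set (Y → TreeAut X)) := by
  rw [Subgroup.le_normalizer_iff]
  intro p hp q hq
  obtain ⟨g, hg, rfl⟩ := mem_stabilizerImage.1 hp
  obtain ⟨k, hk, rfl⟩ := mem_stabilizerImage.1 hq
  refine mem_stabilizerImage.2 ⟨g * k * g⁻¹, conj_mem_of_le_normalizer h hg hk, ?_⟩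
  simp

theorem sectionHom_injective [Nonempty X] {Y : Set (List X)} (hY : IsSpanningLeafSet Y) :
    Function.Injective (sectionHom Y) := by
  rw [injective_iff_map_eq_one]
  intro g hg
  obtain ⟨N, hN⟩ := hY.2
  obtain ⟨x⟩ := ‹Nonempty X›
  refine Subtype.ext (RelIso.ext fun u => ?_)
  obtain ⟨y, hy, w, hw⟩ := hN (u ++ List.replicate N x) (by simp)
  have h1 : (g : TreeAut X) (y ++ w) = y ++ w :=
    apply_append_of_sectionAt_eq_one (g.2 y hy) (congrFun hg ⟨y, hy⟩) w
  rw [hw] at h1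
  exact (apply_left_of_apply_append rfl h1).1

theorem fixer_index_ne_zero [Finite X] {Y : Set (List X)} (hY : Y.Finite) :
    (fixer Y).index ≠ 0 := by
  have : Finite Y := hY
  have h : ⨅ y : Y, MulAction.stabilizer (TreeAut X) (y : List X) ≤ fixer Y := fun g hg y hy =>
    Subgroup.mem_iInf.1 hg ⟨y, hy⟩
  refine fun h0 => Subgroup.index_iInf_ne_zero
    (f := fun y : Y => MulAction.stabilizer (TreeAut X) (y : List X)) (fun y => ?_)
    (Nat.eq_zero_of_zero_dvd (h0 ▸ Subgroup.index_dvd_of_le h))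
  rw [MulAction.index_stabilizer]
  refine (Set.ncard_pos ((List.finite_length_eq X (y : List X).length).subset ?_)).2
    (MulAction.nonempty_orbit _) |>.ne'
  rintro _ ⟨g, rfl⟩
  exact length_apply g y

theorem relIndex_stabilizerImage [Nonempty X] {Y : Set (List X)} (hY : IsSpanningLeafSet Y)
    (M M' : Subgroup (TreeAut X)) :
    (stabilizerImage M Y).relIndex (stabilizerImage M' Y) =
      (M ⊓ fixer Y).relIndex (M' ⊓ fixer Y) := by
  rw [stabilizerImage, stabilizerImage,
    Subgroup.relIndex_map_map_of_injective _ _ (sectionHom_injective hY),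
    ← Subgroup.relIndex_map_map_of_injective _ _ (fixer Y).subtype_injective,
    Subgroup.subgroupOf_map_subtype, Subgroup.subgroupOf_map_subtype]

/-- The data that control the overgroups of `M`: a spanning leaf set `Y`, and a normal subgroup `J`
of finite index of `G` that lies in all coordinate projections of `st_M(Y)`. -/
structure IsFrame (G K M : Subgroup (TreeAut X)) (Y : Set (List X)) (J : Subgroup (TreeAut X))
    (m : ℕ) : Prop where
  isSpanningLeafSet : IsSpanningLeafSet Y
  isBase : IsBase G K J m
  le_map : ∀ y : Y, J ≤ (stabilizerImage M Y).map (Pi.evalMonoidHom (fun _ : Y => TreeAut X) y)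

/-- A frame of `M` serves all overgroups of `M`, which makes their types comparable. -/
theorem IsFrame.mono {G K M M' J : Subgroup (TreeAut X)} {Y : Set (List X)} {m : ℕ}
    (h : IsFrame G K M Y J m) (hM : M ≤ M') : IsFrame G K M' Y J m :=
  ⟨h.1, h.2, fun y => (h.3 y).trans (Subgroup.map_mono (stabilizerImage_mono hM Y))⟩

theorem isInfraDirect_mono {G M M' : Subgroup (TreeAut X)} {Y : Set (List X)}
    (hG : IsSelfSimilar G) (h : IsInfraDirect G (stabilizerImage M Y)) (hM : M ≤ M')
    (hM' : M' ≤ G) : IsInfraDirect G (stabilizerImage M' Y) := by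
  intro y
  refine ⟨?_, fun h0 => (h y).2 (Subgroup.relIndex_eq_zero_of_le_left
    (Subgroup.map_mono (stabilizerImage_mono hM Y)) h0)⟩
  rintro _ ⟨p, hp, rfl⟩
  obtain ⟨g, hg, rfl⟩ := mem_stabilizerImage.1 hp
  exact hG _ (hM' hg) _

theorem isInfraDirect_of_relIndex_ne_zero {G N M : Subgroup (TreeAut X)} {Y : Set (List X)}
    (h : IsInfraDirect G (stabilizerImage M Y)) (hNM : N ≤ M) (hN : N.relIndex M ≠ 0) :
    IsInfraDirect G (stabilizerImage N Y) := by
  intro y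
  refine ⟨(Subgroup.map_mono (stabilizerImage_mono hNM Y)).trans (h y).1, ?_⟩
  refine Subgroup.relIndex_ne_zero_trans ?_ (h y).2
  exact relIndex_map_ne_zero _ (relIndex_map_ne_zero _ (Subgroup.relIndex_comap_ne_zero _ hN))

theorem exists_isFrame {G K M : Subgroup (TreeAut X)} {Y : Set (List X)} (hji : JustInfinite G)
    (hG : IsSelfSimilar G) (htr : IsLevelTransitive G) (hK : IsGraftCore G K)
    (hY : IsSpanningLeafSet Y) (h : IsInfraDirect G (stabilizerImage M Y)) :
    ∃ J m, IsFrame G ⁅K, K⁆ M Y J m := by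
  have : Finite Y := hY.1.1
  choose J hJ hJG hJn using fun y => exists_normalized_finiteIndexIn (h y)
  have hfi : FiniteIndexIn (G ⊓ ⨅ y, J y) G := by
    refine ⟨inf_le_left, ?_⟩
    rw [inf_comm, Subgroup.inf_relIndex_right]
    exact Subgroup.relIndex_iInf_ne_zero fun y => (hJG y).2
  obtain ⟨m, hm⟩ := exists_isBase hji hG htr hK hfi (by
    rw [Subgroup.le_normalizer_iff]
    intro g hg k hk
    refine ⟨G.mul_mem (G.mul_mem hg hk.1) (G.inv_mem hg), Subgroup.mem_iInf.2 fun y => ?_⟩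
    exact conj_mem_of_le_normalizer (hJn y) hg (Subgroup.mem_iInf.1 hk.2 y))
  exact ⟨_, m, hY, hm, fun y => (inf_le_right.trans (iInf_le J y)).trans (hJ y)⟩

/-- The type of `M` with respect to a frame: the moved vertices of all coordinate groups of
`st_M(Y)`. It determines `M` up to finite index among the groups over the frame. -/
def branchType (M : Subgroup (TreeAut X)) (Y : Set (List X)) (m : ℕ) :
    Set (Set Y × Y × List X) :=
  {p | p.2.2 ∈ movedVertices (coordinates (stabilizerImage M Y) p.1 p.2.1) m}

theorem branchType_mono {M M' : Subgroup (TreeAut X)} (h : M ≤ M') (Y : Set (List X)) (m : ℕ) :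
    branchType M Y m ⊆ branchType M' Y m :=
  fun _ hp => movedVertices_mono (coordinates_mono (stabilizerImage_mono h Y) _ _) m hp

theorem branchType_finite [Finite X] {Y : Set (List X)} (hY : Y.Finite)
    (M : Subgroup (TreeAut X)) (m : ℕ) : (branchType M Y m).Finite := by
  have : Finite Y := hY
  refine (Set.finite_univ.prod (Set.finite_univ.prod (List.finite_length_eq X m))).subset ?_
  rintro ⟨s, y, u⟩ hu
  exact ⟨trivial, trivial, hu.1⟩

namespace IsFrame

variable {G K M J : Subgroup (TreeAut X)} {Y : Set (List X)} {m : ℕ}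

theorem le_normalizer_coordinates (h : IsFrame G K M Y J m) (s : Set Y) (y : Y) :
    J ≤ Subgroup.normalizer (coordinates (stabilizerImage M Y) s y : Set (TreeAut X)) := by
  rw [Subgroup.le_normalizer_iff]
  intro j hj a ha
  obtain ⟨p, hp, rfl⟩ := h.le_map y hj
  exact conj_mem_coordinates Subgroup.le_normalizer ha hp

variable [Finite X]

theorem fg (h : IsFrame G K M Y J m) (hfg : G.FG) (hji : JustInfinite G) (hG : IsSelfSimilar G)
    (hK : IsGraftCore G K) (hM : M ≤ G) : M.FG := by
  have := hji.1
  have := nonempty_of_infinite (G := G)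
  have : Finite Y := h.isSpanningLeafSet.1.1
  have h1 : (stabilizerImage M Y).FG := fg_of_coordinates fun s y =>
    fg_of_le_normalizer hfg hji hG hK h.isBase (coordinates_le hG hM s y)
      (h.le_normalizer_coordinates s y)
  have h2 : (M.subgroupOf (fixer Y)).FG := fg_of_map_of_ker (sectionHom Y) h1 (by
    rw [(MonoidHom.ker_eq_bot_iff _).2 (sectionHom_injective h.isSpanningLeafSet), inf_bot_eq]
    exact Subgroup.FG.bot)
  have h3 := fg_map (fixer Y).subtype h2
  rw [Subgroup.subgroupOf_map_subtype] at h3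
  refine fg_of_relIndex_ne_zero inf_le_left (fun h0 => ?_) h3
  rw [inf_comm, Subgroup.inf_relIndex_right] at h0
  exact fixer_index_ne_zero h.isSpanningLeafSet.1.1 (Subgroup.index_eq_zero_of_relIndex_eq_zero h0)

theorem exists_relIndex_le (h : IsFrame G K M Y J m) (hji : JustInfinite G)
    (hG : IsSelfSimilar G) (hK : IsGraftCore G K) :
    ∃ c, ∀ M' : Subgroup (TreeAut X), M ≤ M' → M' ≤ G → branchType M' Y m ⊆ branchType M Y m →
      M.relIndex M' ≠ 0 ∧ M.relIndex M' ≤ c := by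
  have := hji.1
  have := nonempty_of_infinite (G := G)
  have : Finite Y := h.isSpanningLeafSet.1.1
  choose c hc using fun p : Set Y × Y => TreeGroup.exists_relIndex_le hji hG hK h.isBase
    (h.le_normalizer_coordinates p.1 p.2)
  obtain ⟨C, hC⟩ := (Set.finite_range c).bddAbove
  refine ⟨C ^ Nat.card Y * (fixer Y).index, fun M' hMM' hM' ht => ?_⟩
  have h0 := fixer_index_ne_zero h.isSpanningLeafSet.1.1
  obtain ⟨h1, h2⟩ := relIndex_le_pow_of_coordinates (stabilizerImage_mono hMM' Y) (c := C)
    fun s y => by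
      obtain ⟨h1, h2⟩ := hc (s, y) _ (coordinates_le hG hM' s y)
        fun u hu => ht (show (s, y, u) ∈ branchType M' Y m from hu)
      exact ⟨h1, h2.trans (hC (Set.mem_range_self _))⟩
  rw [relIndex_stabilizerImage h.isSpanningLeafSet] at h1 h2
  have h3 : (M' ⊓ fixer Y).relIndex M' = (fixer Y).relIndex M' := by
    rw [inf_comm, Subgroup.inf_relIndex_right]
  have h4 : (fixer Y).relIndex M' ≠ 0 := fun h4 =>
    h0 (Subgroup.index_eq_zero_of_relIndex_eq_zero h4)
  have h5 : (fixer Y).relIndex M' ≤ (fixer Y).index := by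
    rw [← Subgroup.relIndex_top_right] at h0 ⊢
    exact Subgroup.relIndex_le_of_le_right le_top h0
  have h6 := Subgroup.relIndex_mul_relIndex (M ⊓ fixer Y) (M' ⊓ fixer Y) M'
    (inf_le_inf_right _ hMM') inf_le_left
  have h7 : (M ⊓ fixer Y).relIndex M' ≠ 0 := by
    rw [← h6, h3]
    exact mul_ne_zero h1 h4
  refine ⟨fun h8 => h7 (Subgroup.relIndex_eq_zero_of_le_left inf_le_left h8),
    (Subgroup.relIndex_le_of_le_left inf_le_left h7).trans ?_⟩
  rw [← h6, h3]
  exact Nat.mul_le_mul h2 h5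

/-- A group over a frame has finite index in its normalizer: a coordinate group of the normalizer
and the coordinate group of `M` have the same moved vertices, because commutators with the elements
of `J` below a moved vertex lie in the latter. -/
theorem relIndex_ne_zero_of_le_normalizer (h : IsFrame G K M Y J m) (hji : JustInfinite G)
    (hG : IsSelfSimilar G) (hK : IsGraftCore G K) {M' : Subgroup (TreeAut X)} (hMM' : M ≤ M')
    (hM' : M' ≤ G) (hn : M' ≤ Subgroup.normalizer (M : Set (TreeAut X))) :
    M.relIndex M' ≠ 0 := by
  have := hji.1
  obtain ⟨x₀⟩ := nonempty_of_infinite (G := G)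
  obtain ⟨c, hc⟩ := h.exists_relIndex_le hji hG hK
  refine (hc M' hMM' hM' ?_).1
  rintro ⟨s, y, u⟩ hu
  obtain ⟨k, hk⟩ := exists_graft_mem_of_movedVertices hG hK h.isBase
    ((h.mono hMM').le_normalizer_coordinates s y)
  obtain ⟨a, ha, b, hb, hab⟩ := hK.commutator.exists_not_commute
  set v := List.replicate k x₀
  obtain ⟨w, hw⟩ := ne_one_iff_exists_apply_ne.1 hab
  have h1 := hk u hu v (by simp [v]) a ha
  have h2 : graft (u ++ v) b ∈ J := h.isBase.graft_mem _ (by simp [hu.1]) b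
    (K.commutator_le_self hb)
  obtain ⟨q, hq, hqb⟩ := h.le_map y h2
  obtain ⟨p, hp, hps, hpa⟩ := mem_coordinates.1 h1
  refine ⟨hu.1, v ++ w, graft (u ++ v) ⁅a, b⁆, ?_, fun h3 => hw ?_⟩
  · refine mem_coordinates.2 ⟨⁅p, q⁆, commutator_mem_of_le_normalizer
      (stabilizerImage_le_normalizer hn Y) hp hq, fun j hj => ?_, ?_⟩
    · simp [commutatorElement_def, hps j hj]
    · rw [map_commutatorElement, ← hpa, ← hqb]
      rfl
  · rw [← List.append_assoc, graft_apply_append] at h3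
    exact List.append_cancel_left h3

end IsFrame

/-- Only finitely many overgroups of `M` contain `M` with finite index and have the same type as
`M`: they normalize one of finitely many subgroups of finite index of `M`, which have finite index
in their normalizers. -/
theorem IsFrame.finite_overgroups [Finite X] {G K M J : Subgroup (TreeAut X)}
    {Y : Set (List X)} {m : ℕ}
    (h : IsFrame G ⁅K, K⁆ M Y J m) (hfg : G.FG) (hji : JustInfinite G) (hG : IsSelfSimilar G)
    (htr : IsLevelTransitive G) (hK : IsGraftCore G K)
    (hY : IsInfraDirect G (stabilizerImage M Y)) (hM : M ≤ G) :
    {M' : Subgroup (TreeAut X) | M ≤ M' ∧ M' ≤ G ∧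
      branchType M' Y m ⊆ branchType M Y m}.Finite := by
  obtain ⟨c, hc⟩ := h.exists_relIndex_le hji hG hK.commutator
  obtain ⟨𝒩, h𝒩, hfi, hn⟩ := exists_finite_normalized (h.fg hfg hji hG hK.commutator hM) c
  refine (h𝒩.biUnion (t := fun N => {M' : Subgroup (TreeAut X) | N ≤ M' ∧
    M' ≤ G ⊓ Subgroup.normalizer (N : Set (TreeAut X))}) fun N hN => finite_setOf_between ?_).subset
      fun M' hM' => ?_
  · obtain ⟨hNM, hNi⟩ := hfi N hN
    obtain ⟨J', m', h'⟩ := exists_isFrame hji hG htr hK h.isSpanningLeafSet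
      (isInfraDirect_of_relIndex_ne_zero hY hNM hNi)
    exact h'.relIndex_ne_zero_of_le_normalizer hji hG hK.commutator
      (le_inf (hNM.trans hM) Subgroup.le_normalizer) inf_le_left inf_le_right
  · obtain ⟨hMM', hM'G, ht⟩ := hM'
    obtain ⟨h0, hle⟩ := hc M' hMM' hM'G ht
    obtain ⟨N, hN, hNn⟩ := hn M' hMM' h0 hle
    exact Set.mem_biUnion hN ⟨(hfi N hN).1.trans hMM', le_inf hM'G hNn⟩


end TreeGroup

/-! ### Groups with finitely many sections at a vertex -/

namespace TreeGroup

variable {X : Type*}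

/-- The sections at the vertex `y` of the elements of `H`. In general this is not a group, since
`H` need not fix `y`. -/
def sectionsAt (H : Subgroup (TreeAut X)) (y : List X) : Set (TreeAut X) :=
  (fun h => sectionAt h y) '' (H : Set (TreeAut X))

theorem sectionsAt_append_finite {H : Subgroup (TreeAut X)} {y : List X}
    (h : (sectionsAt H y).Finite) (w : List X) : (sectionsAt H (y ++ w)).Finite := by
  refine (h.image fun s => sectionAt s w).subset ?_
  rintro _ ⟨g, hg, rfl⟩
  exact ⟨_, ⟨g, hg, rfl⟩, (sectionAt_append g y w).symm⟩

theorem sectionsAt_infinite_of_graft_mem {H K : Subgroup (TreeAut X)} [Infinite K] {y : List X}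
    (h : ∀ k ∈ K, ∃ g ∈ H, sectionAt g y = k) : (sectionsAt H y).Infinite :=
  (Set.infinite_coe_iff.1 ‹Infinite K›).mono fun k hk => h k hk

theorem sectionsAt_finite_of_relIndex_ne_zero [Finite X] {H M : Subgroup (TreeAut X)}
    (h : H.relIndex M ≠ 0) {y : List X} (hy : (sectionsAt H y).Finite) :
    (sectionsAt M y).Finite := by
  obtain ⟨F, -, -, hF⟩ := exists_cover h
  have h1 : (Set.image2 (fun (t : TreeAut X) (z : List X) => sectionAt t z) F
      {z : List X | z.length = y.length}).Finite :=
    F.finite_toSet.image2 _ (List.finite_length_eq X _)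
  refine (h1.image2 (· * ·) hy).subset ?_
  rintro _ ⟨g, hg, rfl⟩
  obtain ⟨t, ht, htg⟩ := hF g hg
  refine ⟨_, ⟨t, ht, (t⁻¹ * g) y, length_apply _ y, rfl⟩, _, ⟨_, htg, rfl⟩, ?_⟩
  simp only
  rw [← sectionAt_mul, mul_inv_cancel_left]

section JustInfinite

variable {G K : Subgroup (TreeAut X)}

theorem IsGraftCore.infinite (hji : JustInfinite G) (hK : IsGraftCore G K) : Infinite K := by
  have := hji.1
  exact infinite_of_finiteIndexIn ⟨hK.le, hK.relIndex_ne_zero hji⟩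

/-- The two cases of the Grigorchuk-Nagnibeda alternative exclude each other. -/
theorem IsFrame.sectionsAt_infinite {M J : Subgroup (TreeAut X)} {Y : Set (List X)} {m : ℕ}
    (h : IsFrame G K M Y J m) (hji : JustInfinite G) (hK : IsGraftCore G K) (y : List X) :
    (sectionsAt M y).Infinite := by
  have := hji.1
  have := hK.infinite hji
  obtain ⟨x⟩ := nonempty_of_infinite (G := G)
  obtain ⟨N, hN⟩ := h.isSpanningLeafSet.2
  obtain ⟨y₀, hy₀, w, hw⟩ := hN (y ++ List.replicate N x) (by simp)
  intro hfin
  have h1 := sectionsAt_append_finite (sectionsAt_append_finite hfin (List.replicate N x))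
    (List.replicate m x)
  rw [← hw, List.append_assoc] at h1
  refine sectionsAt_infinite_of_graft_mem (K := K) (fun k hk => ?_) h1
  obtain ⟨p, hp, hpk⟩ := h.le_map ⟨y₀, hy₀⟩
    (h.isBase.graft_mem (w ++ List.replicate m x) (by simp) k hk)
  obtain ⟨g, hg, rfl⟩ := mem_stabilizerImage.1 hp
  refine ⟨g, hg, ?_⟩
  rw [sectionAt_append, show sectionAt (g : TreeAut X) y₀ = _ from hpk, sectionAt_graft_self]

theorem nontrivial_of_infinite [Infinite G] : Nontrivial X := by
  by_contra h
  rw [not_nontrivial_iff_subsingleton] at h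
  have : Subsingleton (TreeAut X) := ⟨fun a b => RelIso.ext fun u =>
    List.ext_getElem (by simp) fun _ _ _ => Subsingleton.elim _ _⟩
  exact not_finite G

theorem exists_lt_ncard_level [Finite X] [Nontrivial X] (n N : ℕ) :
    ∃ k, N ≤ k ∧ n < (level X k).ncard := by
  have := Fintype.ofFinite X
  refine ⟨n + N, Nat.le_add_left N n, ?_⟩
  have h1 : (level X (n + N)).ncard = Fintype.card X ^ (n + N) := by
    rw [← card_vector, ← Nat.card_eq_fintype_card]
    exact (Nat.card_coe_set_eq _).symm
  rw [h1]
  exact (Nat.le_add_right n N).trans_lt (Nat.lt_pow_self Fintype.one_lt_card)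

theorem mem_fixer_level_of_mem_copies [Nonempty X] {N n : ℕ} (hN : N ≤ n) {g : TreeAut X}
    (hg : g ∈ copies K (level X n)) : g ∈ fixer (level X N) := by
  obtain ⟨x⟩ := ‹Nonempty X›
  intro u hu
  have h := (hg.2 (u ++ List.replicate (n - N) x) (by
    have : u.length = N := hu
    simp only [level, Set.mem_ofPred_eq, List.length_append, List.length_replicate]
    omega)).1
  exact (apply_left_of_apply_append rfl h).1

/-- If `H` has finitely many sections at a vertex, then its orbits on the subtree below that vertex
are bounded, so that two vertices of that subtree on a common level lie in different orbits. The
group generated by `H` and the group `K^O`, where `O` is one of these orbits, is larger than `H` by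
an infinite index and still has finitely many sections at the other vertex. -/
theorem exists_infinite_index_overgroup [Finite X] (hji : JustInfinite G) (hG : IsSelfSimilar G)
    (hK : IsGraftCore G K) {H : Subgroup (TreeAut X)} (hH : H ≤ G) {y : List X}
    (hy : (sectionsAt H y).Finite) (N : ℕ) :
    ∃ M : Subgroup (TreeAut X), H ≤ M ∧ M ≤ G ∧ H.relIndex M = 0 ∧
      (∀ g ∈ M, ∃ h ∈ H, ∃ f ∈ fixer (level X N), g = h * f) ∧ ∃ z, (sectionsAt M z).Finite := by
  have := hji.1
  have := hK.infinite hji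
  have := nontrivial_of_infinite (G := G)
  obtain ⟨x⟩ := nonempty_of_infinite (G := G)
  obtain ⟨k, hNk, hk⟩ := exists_lt_ncard_level (X := X) (sectionsAt H y).ncard N
  set w₀ := List.replicate k x
  obtain ⟨w, hw, hwn⟩ : ∃ w ∈ level X k, w ∉ (fun s : TreeAut X => s w₀) '' sectionsAt H y := by
    by_contra! hcon
    have h1 := Set.ncard_le_ncard (show level X k ⊆ _ from hcon) (hy.image _)
    exact absurd (h1.trans (Set.ncard_image_le hy)) (not_le.2 hk)
  have hw' : w.length = k := hw
  -- `y ++ w` does not lie in the orbit `O` of `y ++ w₀`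
  have horb : ∀ h ∈ H, h (y ++ w₀) ≠ y ++ w := fun h hh heq =>
    hwn ⟨_, ⟨h, hh, rfl⟩, (apply_left_of_apply_append rfl heq).2⟩
  let O : Set (List X) := {u | ∃ h ∈ H, h (y ++ w₀) = u}
  have hO : O ⊆ level X (y.length + k) := by
    rintro _ ⟨h, -, rfl⟩
    simp [level, w₀]
  have hOlevel := copies_mono_of_subset_level (K := K) hO subset_rfl
  have hn : H ≤ Subgroup.normalizer (copies K O : Set (TreeAut X)) :=
    le_normalizer_copies hG hH hK.le_normalizer (by
      rintro g hg _ ⟨h, hh, rfl⟩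
      exact ⟨g * h, H.mul_mem hg hh, rfl⟩)
  have hsup : ∀ g ∈ H ⊔ copies K O, ∃ h ∈ H, ∃ c ∈ copies K O, g = h * c := by
    intro g hg
    rw [← SetLike.mem_coe, Subgroup.coe_mul_of_left_le_normalizer_right H _ hn] at hg
    obtain ⟨h, hh, c, hc, rfl⟩ := hg
    exact ⟨h, hh, c, hc, rfl⟩
  have hfix : ∀ c ∈ copies K O, ∀ v, c (y ++ w ++ v) = y ++ w ++ v := by
    refine fun c hc v => hc.1 _ ?_
    rintro _ ⟨h, hh, rfl⟩ hp
    have hl : (h (y ++ w₀)).length = (y ++ w).length := by simp [w₀, hw']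
    exact horb h hh ((List.prefix_of_prefix_length_le hp (List.prefix_append _ v)
      hl.le).eq_of_length hl)
  refine ⟨H ⊔ copies K O, le_sup_left, sup_le hH (hOlevel.trans ((hK.copies_le _).trans hK.le)),
    ?_, fun g hg => ?_, y ++ w, ?_⟩
  · by_contra h0
    refine sectionsAt_infinite_of_graft_mem (K := K) (fun a ha => ?_)
      (sectionsAt_finite_of_relIndex_ne_zero h0 (sectionsAt_append_finite hy w₀))
    refine ⟨graft (y ++ w₀) a, Subgroup.mem_sup_right (copies_mono_of_subset_level
      (V := {y ++ w₀}) (by rintro _ rfl; exact ⟨1, H.one_mem, rfl⟩) hO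
      (graft_mem_copies_singleton _ ha)), sectionAt_graft_self _ _⟩
  · obtain ⟨h, hh, c, hc, rfl⟩ := hsup g hg
    exact ⟨h, hh, c, mem_fixer_level_of_mem_copies (hNk.trans (Nat.le_add_left _ _))
      (hOlevel hc), rfl⟩
  · refine (sectionsAt_append_finite hy w).subset ?_
    rintro _ ⟨g, hg, rfl⟩
    obtain ⟨h, hh, c, hc, rfl⟩ := hsup g hg
    have hcw : c (y ++ w) = y ++ w := by simpa using hfix c hc []
    refine ⟨h, hh, ?_⟩
    simp only
    rw [sectionAt_mul, hcw, sectionAt_eq_one (hfix c hc), mul_one]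

end JustInfinite

end TreeGroup

/-! ### The Chabauty topology -/

namespace TreeGroup

open Topology Filter CantorBendixson

section Chabauty

variable {Γ : Type*} [Group Γ]

/-- Two subgroups are close if they have the same elements in a large finite set. -/
theorem mem_nhds_chabauty {L : Subgroup Γ} {U : Set (Subgroup Γ)} :
    U ∈ 𝓝 L ↔ ∃ F : Finset Γ, ∀ M : Subgroup Γ, (∀ g ∈ F, g ∈ M ↔ g ∈ L) → M ∈ U := by
  classical
  rw [nhds_induced, mem_comap]
  constructor
  · rintro ⟨V, hV, hVU⟩
    obtain ⟨W, hWV, hW, hLW⟩ := mem_nhds_iff.1 hV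
    obtain ⟨F, u, hu, hFW⟩ := isOpen_pi_iff.1 hW _ hLW
    refine ⟨F, fun M hM => hVU (hWV (hFW fun g hg => ?_))⟩
    have := (hu g hg).2
    simp only [hM g hg]
    exact this
  · rintro ⟨F, hF⟩
    refine ⟨(F : Set Γ).pi fun g => {decide (g ∈ L)},
      set_pi_mem_nhds F.finite_toSet fun g _ => by simp, fun M hM => hF M fun g hg => ?_⟩
    simpa using hM g hg

theorem accPt_chabauty {L : Subgroup Γ} {D : Set (Subgroup Γ)} :
    AccPt L (𝓟 D) ↔ ∀ F : Finset Γ, ∃ M ∈ D, M ≠ L ∧ ∀ g ∈ F, g ∈ M ↔ g ∈ L := by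
  rw [accPt_iff_nhds]
  constructor
  · intro h F
    obtain ⟨M, hM, hne⟩ := h {M | ∀ g ∈ F, g ∈ M ↔ g ∈ L} (mem_nhds_chabauty.2 ⟨F, fun _ h => h⟩)
    exact ⟨M, hM.2, hne, hM.1⟩
  · intro h U hU
    obtain ⟨F, hF⟩ := mem_nhds_chabauty.1 hU
    obtain ⟨M, hM, hne, hMF⟩ := h F
    exact ⟨M, ⟨hF M hMF, hM⟩, hne⟩

theorem subset_perfectKernel_of_preperfect {S : Type*} [TopologicalSpace S] {P : Set S}
    (hP : Preperfect P) : P ⊆ perfectKernel (Set.univ : Set S) := by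
  refine Set.subset_iInter fun a => ?_
  rw [← iteratedDerivedSet_constant_iff_preperfect.1 hP a]
  exact iteratedDerivedSet_mono (Set.subset_univ P) a

theorem cbRank_lt_omega0_of_notMem {S : Type*} [TopologicalSpace S] {x : S} {n : ℕ}
    (h : x ∉ iteratedDerivedSet (Set.univ : Set S) (n : Ordinal)) :
    cbRank x < ((Ordinal.omega0 : Ordinal) : WithTop Ordinal) := by
  induction n with
  | zero => simp at h
  | succ n ih =>
    by_cases hn : x ∈ iteratedDerivedSet (Set.univ : Set S) (n : Ordinal)
    · rw [cbRank_eq_coe hn (by simpa using h)]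
      exact WithTop.coe_lt_coe.2 (Ordinal.natCast_lt_omega0 n)
    · exact ih hn

theorem notMem_perfectKernel_of_cbRank_lt {S : Type*} [TopologicalSpace S] {x : S}
    {r : WithTop Ordinal} (h : cbRank x < r) : x ∉ perfectKernel (Set.univ : Set S) := by
  intro hx
  refine absurd (cbRank_eq_top fun a _ => ?_) (ne_top_of_lt h)
  exact perfectKernel_subset_iteratedDerivedSet _ _ hx

end Chabauty

/-! ### Series of infinite index -/

section Depth

variable {Γ : Type*} [Group Γ]

theorem HasInfiniteIndexSeries.append {L M : Subgroup Γ} {n : ℕ} (h : HasInfiniteIndexSeries M n)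
    (hLM : L ≤ M) (h0 : L.relIndex M = 0) : HasInfiniteIndexSeries L (n + 1) := by
  obtain ⟨H, hH0, hHn, hH⟩ := h
  have hlt : L < M := lt_of_le_of_ne hLM (by rintro rfl; simp at h0)
  refine ⟨fun i => if i ≤ n then H i else L, by simpa using hH0, by simp, fun i hi => ?_⟩
  rcases Nat.lt_succ_iff_lt_or_eq.1 hi with hi | rfl
  · simpa [hi.le, Nat.succ_le_of_lt hi] using hH i hi
  · simpa [hHn] using ⟨hlt, h0⟩

theorem depth_eq_top {L : Subgroup Γ} (h : ∀ n, HasInfiniteIndexSeries L (n + 1)) :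
    depth L = ⊤ := by
  refine ENat.eq_top_iff_forall_ge.2 fun n => ?_
  have h1 : (n : ℕ∞) ≤ ((n + 1 : ℕ) : ℕ∞) := by exact_mod_cast Nat.le_succ n
  exact h1.trans (le_sSup ⟨n + 1, rfl, h n⟩)

theorem depth_lt_top {L : Subgroup Γ} {N : ℕ} (h : ∀ n, HasInfiniteIndexSeries L n → n ≤ N) :
    depth L < ⊤ := by
  refine lt_of_le_of_lt (sSup_le ?_ : depth L ≤ N) (ENat.natCast_lt_top N)
  rintro _ ⟨n, rfl, hn⟩
  exact_mod_cast h n hn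

end Depth

/-! ### Subgroups of a group of tree automorphisms -/

section Subgroups

variable {X : Type*} {G K : Subgroup (TreeAut X)}

theorem relIndex_map_subtype (M M' : Subgroup G) :
    (M.map G.subtype).relIndex (M'.map G.subtype) = M.relIndex M' :=
  Subgroup.relIndex_map_map_of_injective _ _ G.subtype_injective

theorem fg_map_subtype_iff {M : Subgroup G} : (M.map G.subtype).FG ↔ M.FG :=
  ⟨fun h => fg_of_map_of_ker G.subtype h (by
    rw [(MonoidHom.ker_eq_bot_iff _).2 G.subtype_injective, inf_bot_eq]
    exact Subgroup.FG.bot), fg_map _⟩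

theorem IsBranchingSubgroup.isGraftCore (hji : JustInfinite G) (hK : IsBranchingSubgroup G K) :
    IsGraftCore G K where
  le := hK.1.1
  le_normalizer := (Subgroup.normal_subgroupOf_iff_le_normalizer hK.1.1).1 hK.2.1
  graft_mem u _ hk := hK.2.2.1 u (graft_mem_copies_singleton u hk)
  ne_bot h := by
    have := hji.1
    have := infinite_of_finiteIndexIn hK.1
    subst h
    exact not_finite (⊥ : Subgroup (TreeAut X))

theorem exists_forall_notMem_mul_fixer [Nonempty X] {L : Subgroup G}
    (hwas : HasWellApproximatedSubgroups G) (hL : L.FG) (F : Finset G) : ∃ N, ∀ g ∈ F, g ∉ L →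
      ∀ h ∈ L, ∀ f : G, (f : TreeAut X) ∈ fixer (level X N) → g ≠ h * f := by
  obtain ⟨x⟩ := ‹Nonempty X›
  have key : ∀ g : G, ∃ n, g ∉ L →
      ∀ h ∈ L, ∀ f : G, (f : TreeAut X) ∈ fixer (level X n) → g ≠ h * f := by
    intro g
    by_contra! hcon
    have hgL : g ∉ L := (hcon 0).1
    have hmem : (g : TreeAut X) ∈ ((L.map G.subtype : Subgroup (TreeAut X)) : Set (TreeAut X)) := by
      rw [← hwas _ (Subgroup.map_subtype_le L) (fg_map_subtype_iff.2 hL)]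
      refine Set.mem_iInter.2 fun n => ?_
      obtain ⟨-, h, hh, f, hf, rfl⟩ := hcon n
      exact ⟨h, ⟨h, hh, rfl⟩, f, ⟨f.2, hf⟩, rfl⟩
    obtain ⟨g', hg', heq⟩ := hmem
    exact hgL (Subtype.ext heq ▸ hg')
  choose n hn using key
  refine ⟨F.sup n, fun g hgF hgL h hh f hf => hn g hgL h hh f fun u hu => ?_⟩
  have hle : n g ≤ F.sup n := Finset.le_sup hgF
  have hfu := hf (u ++ List.replicate (F.sup n - n g) x) (by
    have : u.length = n g := hu
    simp only [level, Set.mem_ofPred_eq, List.length_append, List.length_replicate]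
    omega)
  exact (apply_left_of_apply_append rfl hfu).1

variable [Finite X] {L M : Subgroup G} {J : Subgroup (TreeAut X)} {Y : Set (List X)} {m : ℕ}

/-- Each overgroup of `M` near `M` other than `M` has a strictly larger type. -/
theorem IsFrame.exists_finset_isolating (h : IsFrame G ⁅K, K⁆ (M.map G.subtype) Y J m)
    (hfg : G.FG) (hji : JustInfinite G) (hG : IsSelfSimilar G) (htr : IsLevelTransitive G)
    (hK : IsGraftCore G K) (hY : IsInfraDirect G (stabilizerImage (M.map G.subtype) Y)) :
    ∃ F : Finset G, ∀ M' : Subgroup G, M' ≠ M → (∀ g ∈ F, g ∈ M' ↔ g ∈ M) →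
      M ≤ M' ∧ ¬ branchType (M'.map G.subtype) Y m ⊆ branchType (M.map G.subtype) Y m := by
  classical
  obtain ⟨S, hS⟩ := fg_map_subtype_iff.1 (h.fg hfg hji hG hK.commutator (Subgroup.map_subtype_le M))
  have hfin : {M' : Subgroup G | M < M' ∧
      branchType (M'.map G.subtype) Y m ⊆ branchType (M.map G.subtype) Y m}.Finite := by
    refine Set.Finite.of_finite_image (f := Subgroup.map G.subtype)
      ((h.finite_overgroups hfg hji hG htr hK hY (Subgroup.map_subtype_le M)).subset ?_)
      (Subgroup.map_injective G.subtype_injective).injOn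
    rintro _ ⟨M', ⟨hlt, ht⟩, rfl⟩
    exact ⟨Subgroup.map_mono hlt.le, Subgroup.map_subtype_le M', ht⟩
  have hex : ∀ M' : Subgroup G, M < M' → ∃ g ∈ M', g ∉ M := fun M' hlt =>
    SetLike.exists_of_lt hlt
  choose! g hg hg' using hex
  refine ⟨S ∪ hfin.toFinset.image g, fun M' hne hM' => ?_⟩
  have hle : M ≤ M' := by
    rw [← hS, Subgroup.closure_le]
    intro s hs
    refine (hM' s (Finset.mem_union_left _ hs)).2 ?_
    rw [← hS]
    exact Subgroup.subset_closure hs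
  refine ⟨hle, fun ht => ?_⟩
  have hlt : M < M' := lt_of_le_of_ne hle hne.symm
  exact hg' M' hlt ((hM' _ (Finset.mem_union_right _ (Finset.mem_image_of_mem g
    (hfin.mem_toFinset.2 ⟨hlt, ht⟩)))).1 (hg M' hlt))

/-- The derivatives lose the overgroups of `L` in the order of decreasing types. -/
theorem IsFrame.notMem_iteratedDerivedSet (h : IsFrame G ⁅K, K⁆ (L.map G.subtype) Y J m)
    (hfg : G.FG) (hji : JustInfinite G) (hG : IsSelfSimilar G) (htr : IsLevelTransitive G)
    (hK : IsGraftCore G K) (hY : IsInfraDirect G (stabilizerImage (L.map G.subtype) Y)) (d : ℕ) :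
    ∀ M : Subgroup G, L ≤ M →
      (branchType G Y m).ncard < (branchType (M.map G.subtype) Y m).ncard + d →
      M ∉ iteratedDerivedSet (Set.univ : Set (Subgroup G)) (d : Ordinal) := by
  have hfin := branchType_finite (m := m) h.isSpanningLeafSet.1.1
  induction d with
  | zero =>
    intro M _ hlt
    exact absurd (Set.ncard_le_ncard (branchType_mono (Subgroup.map_subtype_le M) Y m) (hfin _))
      (not_le.2 hlt)
  | succ d ih =>
    intro M hLM hlt hmem
    rw [Nat.cast_succ, iteratedDerivedSet_succ] at hmem
    have hle := Subgroup.map_mono (f := G.subtype) hLM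
    obtain ⟨F, hF⟩ := (h.mono hle).exists_finset_isolating hfg hji hG htr hK
      (isInfraDirect_mono hG hY hle (Subgroup.map_subtype_le M))
    obtain ⟨M', hM', hne, hM'F⟩ := accPt_chabauty.1 hmem.1 F
    obtain ⟨hMM', ht⟩ := hF M' hne hM'F
    refine ih M' (hLM.trans hMM') ?_ hM'
    have hss : branchType (M.map G.subtype) Y m ⊂ branchType (M'.map G.subtype) Y m :=
      ⟨branchType_mono (Subgroup.map_mono hMM') Y m, ht⟩
    have := Set.ncard_lt_ncard hss (hfin _)
    omega

/-- The type shrinks at each step of infinite index of a series that descends to `L`. -/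
theorem IsFrame.length_le_ncard (h : IsFrame G K (L.map G.subtype) Y J m)
    (hji : JustInfinite G) (hG : IsSelfSimilar G) (hK : IsGraftCore G K) {n : ℕ}
    (hn : HasInfiniteIndexSeries L n) : n ≤ (branchType G Y m).ncard := by
  obtain ⟨H, -, hHn, hH⟩ := hn
  have hfin := branchType_finite (m := m) h.isSpanningLeafSet.1.1
  have key : ∀ k ≤ n, L ≤ H (n - k) ∧ k ≤ (branchType ((H (n - k)).map G.subtype) Y m).ncard := by
    intro k
    induction k with
    | zero => exact fun _ => ⟨hHn.ge, Nat.zero_le _⟩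
    | succ k ih =>
      intro hk
      obtain ⟨h1, h2⟩ := ih (Nat.le_of_succ_le hk)
      obtain ⟨hlt, h0⟩ := hH (n - (k + 1)) (by omega)
      rw [show n - (k + 1) + 1 = n - k by omega] at hlt h0
      refine ⟨h1.trans hlt.le, ?_⟩
      obtain ⟨c, hc⟩ := (h.mono (Subgroup.map_mono h1)).exists_relIndex_le hji hG hK
      have hss : branchType ((H (n - k)).map G.subtype) Y m ⊂
          branchType ((H (n - (k + 1))).map G.subtype) Y m := by
        refine ⟨branchType_mono (Subgroup.map_mono hlt.le) Y m, fun hsub => ?_⟩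
        refine (hc _ (Subgroup.map_mono hlt.le) (Subgroup.map_subtype_le _) hsub).1 ?_
        rw [relIndex_map_subtype, h0]
      have := Set.ncard_lt_ncard hss (hfin _)
      omega
  exact (key n le_rfl).2.trans
    (Set.ncard_le_ncard (branchType_mono (Subgroup.map_subtype_le _) Y m) (hfin _))

theorem exists_overgroup (hji : JustInfinite G) (hG : IsSelfSimilar G) (hK : IsGraftCore G K)
    {y : List X} (hy : (sectionsAt (L.map G.subtype) y).Finite) (N : ℕ) :
    ∃ M : Subgroup G, L ≤ M ∧ L.relIndex M = 0 ∧
      (∀ g ∈ M, ∃ h ∈ L, ∃ f : G, (f : TreeAut X) ∈ fixer (level X N) ∧ g = h * f) ∧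
      ∃ z, (sectionsAt (M.map G.subtype) z).Finite := by
  obtain ⟨M, hLM, hMG, h0, hM, z, hz⟩ :=
    exists_infinite_index_overgroup hji hG hK (Subgroup.map_subtype_le L) hy N
  have hmap : (M.subgroupOf G).map G.subtype = M := by
    rw [Subgroup.subgroupOf_map_subtype, inf_eq_left.2 hMG]
  refine ⟨M.subgroupOf G, fun g hg => hLM ⟨g, hg, rfl⟩, ?_, fun g hg => ?_, z, by rwa [hmap]⟩
  · rw [← relIndex_map_subtype, hmap, h0]
  · obtain ⟨_, ⟨h, hh, rfl⟩, f, hf, hgf⟩ := hM g hg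
    have hfG : f = ((h⁻¹ * g : G) : TreeAut X) := by
      rw [Subgroup.coe_mul, hgf]
      simp
    exact ⟨h, hh, h⁻¹ * g, hfG ▸ hf, by simp⟩

theorem hasInfiniteIndexSeries_of_finite_sectionsAt (hji : JustInfinite G) (hG : IsSelfSimilar G)
    (hK : IsGraftCore G K) (n : ℕ) : ∀ (L : Subgroup G) {y : List X},
      (sectionsAt (L.map G.subtype) y).Finite → HasInfiniteIndexSeries L (n + 1) := by
  have := hK.infinite hji
  induction n with
  | zero =>
    intro L y hy
    refine HasInfiniteIndexSeries.append ⟨fun _ => ⊤, rfl, rfl, by simp⟩ le_top ?_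
    by_contra h0
    rw [← relIndex_map_subtype] at h0
    refine sectionsAt_infinite_of_graft_mem (K := K) (fun k hk => ?_)
      (sectionsAt_finite_of_relIndex_ne_zero h0 hy)
    exact ⟨graft y k, ⟨⟨_, hK.le (hK.graft_mem y k hk)⟩, trivial, rfl⟩, sectionAt_graft_self y k⟩
  | succ n ih =>
    intro L y hy
    obtain ⟨M, hLM, h0, -, z, hz⟩ := exists_overgroup hji hG hK hy 0
    exact (ih M hz).append hLM h0

/-- The subgroups without an infra-direct stabilizer form a set without isolated points. The
finitely generated ones have finitely many sections at some vertex, and are limits of overgroups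
with the same property; the others are limits of their finitely generated subgroups. -/
theorem preperfect_setOf_not_isInfraDirect (hji : JustInfinite G) (hG : IsSelfSimilar G)
    (htr : IsLevelTransitive G) (hK : IsGraftCore G K) (hwas : HasWellApproximatedSubgroups G)
    (hGN : GrigorchukNagnibedaAlternative G) :
    Preperfect {L : Subgroup G | ¬ ∃ Y : Set (List X), IsSpanningLeafSet Y ∧
      IsInfraDirect G (stabilizerImage (L.map G.subtype) Y)} := by
  classical
  have := hji.1
  have := nonempty_of_infinite (G := G)
  intro L hL
  refine accPt_chabauty.2 fun F => ?_
  by_cases hLfg : L.FG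
  · obtain ⟨y, hy⟩ :=
      (hGN _ (Subgroup.map_subtype_le L) (fg_map_subtype_iff.2 hLfg)).resolve_right hL
    obtain ⟨N, hN⟩ := exists_forall_notMem_mul_fixer hwas hLfg F
    obtain ⟨M, hLM, h0, hM, z, hz⟩ := exists_overgroup hji hG hK hy N
    refine ⟨M, ?_, ?_, fun g hg => ⟨fun hgM => ?_, fun hgL => hLM hgL⟩⟩
    · rintro ⟨Y, hY, hYM⟩
      obtain ⟨J, m, hJ⟩ := exists_isFrame hji hG htr hK hY hYM
      exact hJ.sectionsAt_infinite hji hK.commutator z hz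
    · rintro rfl
      simp at h0
    · by_contra hgL
      obtain ⟨h, hh, f, hf, hgf⟩ := hM g hgM
      exact hN g hg hgL h hh f hf hgf
  · have hle : Subgroup.closure ((F.filter (· ∈ L) : Finset G) : Set G) ≤ L := by
      rw [Subgroup.closure_le]
      intro g hg
      exact (Finset.mem_filter.1 hg).2
    refine ⟨_, ?_, ?_, fun g hg => ⟨fun h => hle h, fun hgL =>
      Subgroup.subset_closure (Finset.mem_filter.2 ⟨hg, hgL⟩)⟩⟩
    · rintro ⟨Y, hY, hYM⟩
      exact hL ⟨Y, hY, isInfraDirect_mono hG hYM (Subgroup.map_mono hle)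
        (Subgroup.map_subtype_le L)⟩
    · rintro h
      exact hLfg ⟨_, h⟩

end Subgroups

end TreeGroup

theorem mainTheorem5 {X : Type*} [Finite X] (G : Subgroup (TreeGroup.TreeAut X))
    (hfg : G.FG)
    (hbranch : TreeGroup.IsRegularBranch G)
    (hji : TreeGroup.JustInfinite G)
    (hrep : TreeGroup.IsStronglySelfReplicating G)
    (hwas : TreeGroup.HasWellApproximatedSubgroups G)
    (hGN : TreeGroup.GrigorchukNagnibedaAlternative G)
    (L : Subgroup G) :
    List.TFAE [
      L ∉ CantorBendixson.perfectKernel (Set.univ : Set (Subgroup G)),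
      ∃ Y : Set (List X), TreeGroup.IsSpanningLeafSet Y ∧
        TreeGroup.IsInfraDirect G (TreeGroup.stabilizerImage (L.map G.subtype) Y),
      TreeGroup.cbRank L < ((Ordinal.omega0 : Ordinal) : WithTop Ordinal),
      TreeGroup.depth L < ⊤ ∧ L.FG] := by
  obtain ⟨hG, htr, K, hK'⟩ := hbranch
  have hK := hK'.isGraftCore hji
  tfae_have 1 → 2 := by
    intro h
    by_contra h2
    exact h (subset_perfectKernel_of_preperfect
      (preperfect_setOf_not_isInfraDirect hji hG htr hK hwas hGN) h2)
  tfae_have 2 → 3 := by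
    rintro ⟨Y, hY, h⟩
    obtain ⟨J, m, hJ⟩ := exists_isFrame hji hG htr hK hY h
    exact cbRank_lt_omega0_of_notMem (hJ.notMem_iteratedDerivedSet hfg hji hG htr hK h
      ((branchType (G : Subgroup (TreeAut X)) Y m).ncard + 1) L le_rfl (by omega))
  tfae_have 3 → 1 := notMem_perfectKernel_of_cbRank_lt
  tfae_have 2 → 4 := by
    rintro ⟨Y, hY, h⟩
    obtain ⟨J, m, hJ⟩ := exists_isFrame hji hG htr hK hY h
    exact ⟨depth_lt_top fun n hn => hJ.length_le_ncard hji hG hK.commutator hn,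
      fg_map_subtype_iff.1 (hJ.fg hfg hji hG hK.commutator (Subgroup.map_subtype_le L))⟩
  tfae_have 4 → 2 := by
    rintro ⟨hd, hL⟩
    refine (hGN _ (Subgroup.map_subtype_le L) (fg_map_subtype_iff.2 hL)).resolve_left ?_
    rintro ⟨y, hy⟩
    exact hd.ne (depth_eq_top fun n =>
      hasInfiniteIndexSeries_of_finite_sectionsAt hji hG hK n L hy)
  tfae_finish
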